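/- Let $\kappa$ be an infinite regular cardinal with $\kappa^{<\kappa}=\kappa$. Fix a many-sorted signature (any set of sorts, any set of function and relation symbols) in which every symbol takes fewer than $\kappa$ arguments. The $(\kappa^+,\kappa,\kappa)$-coherent formulas are built from atomic formulas (equalities of terms and relation symbols applied to terms) by conjunctions of fewer than $\kappa$ formulas, disjunctions of at most $\kappa$ formulas, and existential quantification over fewer than $\kappa$ variables; every formula is considered in a context of fewer than $\kappa$ variables. A sequent $\varphi\vdash_{\mathbf x}\psi$ consists of two such formulas in a common context $\mathbf x$ of fewer than $\kappa$ variables. The $(\kappa^+,\kappa,\kappa)$-coherent fragment is the deductive system for such sequents with the following axioms and rules: 1. identity $\varphi\vdash_{\mathbf x}\varphi$, cut, and substitution of terms for the variables of the context; 2. $\top\vdash_x x=x$ and $(\mathbf x=\mathbf y)\wedge\varphi[\mathbf x/\mathbf w]\vdash_{\mathbf z}\varphi[\mathbf y/\mathbf w]$; 3. $\bigwedge_{i\in I}\varphi_i\vdash_{\mathbf x}\varphi_j$, and from $\varphi\vdash_{\mathbf x}\psi_i$ for all $i\in I$ infer $\varphi\vdash_{\mathbf x}\bigwedge_{i\in I}\psi_i$,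 for $|I|<\kappa$; 4. $\varphi_j\vdash_{\mathbf x}\bigvee_{i\in I}\varphi_i$, and from $\varphi_i\vdash_{\mathbf x}\theta$ for all $i\in I$ infer $\bigvee_{i\in I}\varphi_i\vdash_{\mathbf x}\theta$, for $|I|\le\kappa$; 5. $\varphi\vdash_{\mathbf x\mathbf y}\psi$ and $\exists\mathbf y\,\varphi\vdash_{\mathbf x}\psi$ may be inferred from each other, when no variable of $\mathbf y$ is free in $\psi$; 6. transfinite transitivity. Let $\gamma\le\kappa$ be a cardinal, and let a formula $\varphi_f$ in a context $\mathbf y_f$ be given for every node $f$ of the tree $\gamma^{<\kappa}$, such that for every immediate successor $g$ of $f$ the context $\mathbf y_g$ is $\mathbf y_f$ together with a set $\mathbf x_g$ of new variables, and $\mathbf y_f=\bigcup_{\alpha<\beta}\mathbf y_{f|_\alpha}$ for $f$ of limit length $\beta$. From the premises $$\varphi_f\vdash_{\mathbf y_f}\bigvee_{g\in\gamma^{\beta+1},\,g|_\beta=f}\exists\mathbf x_g\,\varphi_g\quad(\beta<\kappa,\ f\in\gamma^\beta),\qquad \varphi_f\dashv\vdash_{\mathbf y_f}\bigwedge_{\alpha<\beta}\varphi_{f|_\alpha}\quad(\beta<\kappa\text{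 limit},\ f\in\gamma^\beta)$$ infer $$\varphi_\emptyset\vdash_{\mathbf y_\emptyset}\bigvee_{f\in B}\exists(\mathbf x_{f|_{\beta+1}})_{\beta<\delta_f}\bigwedge_{\beta<\delta_f}\varphi_{f|_{\beta+1}},$$ where $B$ is the set of minimal elements of an upward closed set of nodes that meets every branch of the tree $\gamma^\kappa$, and $\delta_f$ is the length of $f$. A set-valued structure interprets each sort by a set (possibly empty), function symbols by functions and relation symbols by relations; $\varphi\vdash_{\mathbf x}\psi$ holds in it if every assignment of the variables $\mathbf x$ that satisfies $\varphi$ satisfies $\psi$. **Theorem.** Let $T$ be a set of at most $\kappa$ such sequents. If a sequent holds in every set-valued model of $T$ all of whose carrier sets have cardinality at most $\kappa$, then it is derivable from $T$ in the $(\kappa^+,\kappa,\kappa)$-coherent fragment. In particular, every sequent that holds in all set-valued models of $T$ is derivable from $T$. -/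

import Mathlib

universe u

open Cardinal

namespace InfLogic

/-- A context over a set `S` of sorts: for each sort, the set of variables of that sort. -/
abbrev Ctx (S : Type u) : Type (u + 1) := S → Type u

/-- A context with fewer than `κ` variables in total. -/
def IsSmallCtx (κ : Cardinal.{u}) {S : Type u} (Γ : Ctx S) : Prop :=
  #(Σ s, Γ s) < κ

/-- Juxtaposition of two contexts. -/
abbrev Ctx.append {S : Type u} (Γ Y : Ctx S) : Ctx S := fun s => Γ s ⊕ Y s

/-- A many-sorted signature whose function and relation symbols take fewer than `κ` arguments.
`dom f s` is the set of argument places of sort `s` of `f`. -/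
structure Signature (κ : Cardinal.{u}) where
  Sorts : Type u
  Func : Type u
  Rel : Type u
  dom : Func → Ctx Sorts
  cod : Func → Sorts
  arity : Rel → Ctx Sorts
  dom_small : ∀ f, IsSmallCtx κ (dom f)
  arity_small : ∀ R, IsSmallCtx κ (arity R)

variable {κ : Cardinal.{u}}

/-! ### Syntax -/

/-- Terms with variables in the context `Γ`, indexed by their sort. -/
inductive Term (L : Signature κ) (Γ : Ctx L.Sorts) : L.Sorts → Type u
  | var {s : L.Sorts} (x : Γ s) : Term L Γ s
  | app (f : L.Func) (t : ∀ s, L.dom f s → Term L Γ s) : Term L Γ (L.cod f)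

/-- The `(κ⁺, κ, κ)`-coherent formulas in the context `Γ`: conjunctions of fewer than `κ` formulas,
disjunctions of at most `κ` formulas, existential quantification over fewer than `κ` variables.
The quantifier `ex Y` binds the variables of the block `Y`, which are adjoined to the context. -/
inductive Fml (L : Signature κ) : Ctx L.Sorts → Type (u + 1)
  | eq {Γ : Ctx L.Sorts} {s : L.Sorts} (t t' : Term L Γ s) : Fml L Γ
  | rel {Γ : Ctx L.Sorts} (R : L.Rel) (t : ∀ s, L.arity R s → Term L Γ s) : Fml L Γ
  | conj {Γ : Ctx L.Sorts} (ι : Type u) (hι : #ι < κ) (φ : ι → Fml L Γ) : Fml L Γ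
  | disj {Γ : Ctx L.Sorts} (ι : Type u) (hι : #ι ≤ κ) (φ : ι → Fml L Γ) : Fml L Γ
  | ex {Γ : Ctx L.Sorts} (Y : Ctx L.Sorts) (hY : IsSmallCtx κ Y) (φ : Fml L (Γ.append Y)) : Fml L Γ

variable {L : Signature κ}

/-- Simultaneous substitution of terms for variables in a term. -/
def Term.subst {Γ Δ : Ctx L.Sorts} (σ : ∀ s, Γ s → Term L Δ s) :
    ∀ {s : L.Sorts}, Term L Γ s → Term L Δ s
  | _, .var x => σ _ x
  | _, .app f t => .app f fun s i => (t s i).subst σ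

/-- Extension of a substitution by the identity on a block of bound variables. -/
def liftSubst {Γ Δ : Ctx L.Sorts} (Y : Ctx L.Sorts) (σ : ∀ s, Γ s → Term L Δ s) :
    ∀ s, Γ.append Y s → Term L (Δ.append Y) s
  | s, .inl x => (σ s x).subst fun _ y => .var (.inl y)
  | _, .inr y => .var (.inr y)

/-- Simultaneous substitution of terms for the free variables of a formula. -/
def Fml.subst : ∀ {Γ Δ : Ctx L.Sorts}, Fml L Γ → (∀ s, Γ s → Term L Δ s) → Fml L Δ
  | _, _, .eq t t', σ => .eq (t.subst σ) (t'.subst σ)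
  | _, _, .rel R t, σ => .rel R fun s i => (t s i).subst σ
  | _, _, .conj ι hι φ, σ => .conj ι hι fun i => (φ i).subst σ
  | _, _, .disj ι hι φ, σ => .disj ι hι fun i => (φ i).subst σ
  | _, _, .ex Y hY φ, σ => .ex Y hY (φ.subst (liftSubst Y σ))

/-- Renaming of free variables. -/
def Fml.rename {Γ Δ : Ctx L.Sorts} (φ : Fml L Γ) (ρ : ∀ s, Γ s → Δ s) : Fml L Δ :=
  φ.subst fun s x => .var (ρ s x)

/-- Truth, the empty conjunction. -/
def Fml.top (hκ : ℵ₀ ≤ κ) {Γ : Ctx L.Sorts} : Fml L Γ :=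
  .conj PEmpty (by simpa using aleph0_pos.trans_le hκ) PEmpty.elim

/-- Binary conjunction. -/
def Fml.and (hκ : ℵ₀ ≤ κ) {Γ : Ctx L.Sorts} (φ ψ : Fml L Γ) : Fml L Γ :=
  .conj (ULift Bool) ((lt_aleph0_of_finite _).trans_le hκ) fun b => cond b.down φ ψ

/-- A sequent `lhs ⊢ rhs` of coherent formulas in a context of fewer than `κ` variables. -/
structure Sequent (L : Signature κ) where
  ctx : Ctx L.Sorts
  small : IsSmallCtx κ ctx
  lhs : Fml L ctx
  rhs : Fml L ctx

/-! ### Contexts inside a common pool of variables -/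

section Pool

variable {S : Type u} {V : Ctx S}

/-- A set of variables from the pool `V`, regarded as a context. -/
abbrev toCtx (X : ∀ s, Set (V s)) : Ctx S := fun s => X s

/-- The variables that are in `X'` and not in `X`. -/
abbrev newVars (X X' : ∀ s, Set (V s)) : ∀ s, Set (V s) := fun s => X' s \ X s

theorem isSmallCtx_newVars {X X' : ∀ s, Set (V s)} (h : IsSmallCtx κ (toCtx X')) :
    IsSmallCtx κ (toCtx (newVars X X')) := by
  refine lt_of_le_of_lt (mk_le_of_injective
    (f := fun p : (Σ s, toCtx (newVars X X') s) =>
      (⟨p.1, ⟨p.2.1, p.2.2.1⟩⟩ : Σ s, toCtx X' s)) ?_) h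
  rintro ⟨s, x, hx⟩ ⟨s', x', hx'⟩ hxx
  simp only [Sigma.mk.injEq] at hxx
  obtain ⟨rfl, hxx⟩ := hxx
  have := congrArg Subtype.val (eq_of_heq hxx)
  dsimp only at this
  subst this
  rfl

open Classical in
/-- Each variable of `X'` is either one of `X` or a new one. -/
noncomputable def splitVars (X X' : ∀ s, Set (V s)) :
    ∀ s, toCtx X' s → Ctx.append (toCtx X) (toCtx (newVars X X')) s := fun s v =>
  if h : v.1 ∈ X s then .inl ⟨v.1, h⟩ else .inr ⟨v.1, v.2, h⟩

end Pool

/-- The formula `φ` in the context `X`, weakened to the larger context `X'`. -/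
def Fml.weaken {V : Ctx L.Sorts} {X X' : ∀ s, Set (V s)} (h : ∀ s, X s ⊆ X' s)
    (φ : Fml L (toCtx X)) : Fml L (toCtx X') :=
  φ.rename fun s => Set.inclusion (h s)

/-- `∃ x, φ`, where `x` consists of the variables of the context `X'` of `φ` that are not in `X`. -/
noncomputable def Fml.exNew {V : Ctx L.Sorts} (X : ∀ s, Set (V s)) {X' : ∀ s, Set (V s)}
    (hX' : IsSmallCtx κ (toCtx X')) (φ : Fml L (toCtx X')) : Fml L (toCtx X) :=
  .ex (toCtx (newVars X X')) (isSmallCtx_newVars hX') (φ.rename (splitVars X X'))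

/-! ### The tree of sequences of length less than `κ` -/

/-- A node of the tree `G^{<κ}`: a function to `G` from the ordinals below some ordinal
`level < κ`. -/
structure Node (κ : Cardinal.{u}) (G : Type u) where
  level : κ.ord.ToType
  val : Set.Iio level → G

namespace Node

variable {G : Type u}

/-- `f ≤ g` if `f` is a restriction of `g`. -/
instance : LE (Node κ G) where
  le f g := ∃ h : f.level ≤ g.level, ∀ i : Set.Iio f.level, f.val i = g.val ⟨i, i.2.trans_le h⟩

/-- `g` is an immediate successor of `f`. -/
def IsChild (f g : Node κ G) : Prop := f ≤ g ∧ f.level ⋖ g.level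

/-- The proper restrictions of `f`. -/
def Pred (f : Node κ G) : Type u := {h : Node κ G // h ≤ f ∧ h.level < f.level}

/-- The restrictions of `f` to successor ordinals. -/
def SuccPred (f : Node κ G) : Type u := {h : Node κ G // h ≤ f ∧ ∃ β, β ⋖ h.level}

theorem ext_of {f g : Node κ G} (hl : f.level = g.level)
    (hv : ∀ i (hi : i < f.level) (hi' : i < g.level), f.val ⟨i, hi⟩ = g.val ⟨i, hi'⟩) : f = g := by
  obtain ⟨a, f⟩ := f
  obtain ⟨b, g⟩ := g
  dsimp only at hl
  subst hl
  congr 1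
  funext i
  exact hv i i.2 i.2

theorem level_injOn_le {f h h' : Node κ G} (hh : h ≤ f) (hh' : h' ≤ f)
    (hl : h.level = h'.level) : h = h' := by
  obtain ⟨_, h1⟩ := hh
  obtain ⟨_, h2⟩ := hh'
  exact ext_of hl fun i hi hi' => (h1 ⟨i, hi⟩).trans (h2 ⟨i, hi'⟩).symm

theorem mk_pred_lt (f : Node κ G) : #f.Pred < κ := by
  refine lt_of_le_of_lt (mk_le_of_injective
    (f := fun h : f.Pred => (⟨h.1.level, h.2.2⟩ : Set.Iio f.level)) ?_) (mk_Iio_toType_ord_lt _)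
  intro h h' hh
  exact Subtype.ext (level_injOn_le h.2.1 h'.2.1 (congrArg Subtype.val hh))

theorem mk_succPred_lt (hκ : ℵ₀ ≤ κ) (f : Node κ G) : #f.SuccPred < κ := by
  have h1 : #f.SuccPred ≤ #(Option (Set.Iio f.level)) := by
    classical
    refine mk_le_of_injective (f := fun h : f.SuccPred =>
      if hl : h.1.level < f.level then some (⟨h.1.level, hl⟩ : Set.Iio f.level) else none) ?_
    intro h h' hh
    refine Subtype.ext (level_injOn_le h.2.1 h'.2.1 ?_)
    have e1 : h.1.level ≤ f.level := h.2.1.1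
    have e2 : h'.1.level ≤ f.level := h'.2.1.1
    dsimp only at hh
    split_ifs at hh with a b b
    · exact congrArg Subtype.val (Option.some.inj hh)
    · exact (le_antisymm e1 (not_lt.1 a)).trans (le_antisymm e2 (not_lt.1 b)).symm
  refine h1.trans_lt ?_
  rw [mk_option]
  exact add_lt_of_lt hκ (mk_Iio_toType_ord_lt _) (one_lt_aleph0.trans_le hκ)

theorem mk_children_le (hG : #G ≤ κ) (f : Node κ G) : #{g : Node κ G // f.IsChild g} ≤ κ := by
  refine (mk_le_of_injective
    (f := fun g : {g : Node κ G // f.IsChild g} => g.1.val ⟨f.level, g.2.2.lt⟩) ?_).trans hG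
  rintro ⟨g, ⟨hg1, hg2⟩, hg⟩ ⟨g', ⟨hg1', hg2'⟩, hg'⟩ hh
  refine Subtype.ext (ext_of (hg.unique_right hg') fun i hi hi' => ?_)
  rcases lt_or_eq_of_le (hg.le_of_lt hi) with h | h
  · exact (hg2 ⟨i, h⟩).symm.trans (hg2' ⟨i, h⟩)
  · subst h
    exact hh

/-- The initial segment of length `β` of a branch of the tree `G^κ`. -/
def ofBranch (b : κ.ord.ToType → G) (β : κ.ord.ToType) : Node κ G := ⟨β, fun i => b i⟩

/-- A bar over the tree `G^κ`: an upward closed set of nodes that meets every branch. -/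
def IsBar (D : Set (Node κ G)) : Prop :=
  IsUpperSet D ∧ ∀ b : κ.ord.ToType → G, ∃ β, ofBranch b β ∈ D

/-- The minimal elements of a set of nodes. -/
def MinNode (D : Set (Node κ G)) : Type u := {f : Node κ G // Minimal (· ∈ D) f}

end Node

/-! ### The deductive system -/

/-- `Prf T φ ψ`: the sequent `φ ⊢ ψ`, in the context `Γ` of the two formulas, is derivable from the
axioms in `T` in the `(κ⁺, κ, κ)`-coherent fragment. -/
inductive Prf (T : Set (Sequent L)) : ∀ {Γ : Ctx L.Sorts}, Fml L Γ → Fml L Γ → Prop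
  | ax (τ : Sequent L) (hτ : τ ∈ T) : Prf T τ.lhs τ.rhs
  | id {Γ : Ctx L.Sorts} (hΓ : IsSmallCtx κ Γ) (φ : Fml L Γ) : Prf T φ φ
  | subst {Γ Δ : Ctx L.Sorts} (hΔ : IsSmallCtx κ Δ) (σ : ∀ s, Γ s → Term L Δ s) {φ ψ : Fml L Γ} :
      Prf T φ ψ → Prf T (φ.subst σ) (ψ.subst σ)
  | cut {Γ : Ctx L.Sorts} {φ ψ θ : Fml L Γ} : Prf T φ ψ → Prf T ψ θ → Prf T φ θ
  | eq_refl (hκ : ℵ₀ ≤ κ) {Γ : Ctx L.Sorts} (hΓ : IsSmallCtx κ Γ) {s : L.Sorts} (x : Γ s) :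
      Prf T (.top hκ) (.eq (.var x) (.var x))
  /-- `(x = y) ∧ φ[x/w] ⊢ φ[y/w]`, where `w` is the context `W` -/
  | eq_subst (hκ : ℵ₀ ≤ κ) {Γ W : Ctx L.Sorts} (hΓ : IsSmallCtx κ Γ) (hW : IsSmallCtx κ W)
      (x y : ∀ s, W s → Γ s) (φ : Fml L (Γ.append W)) :
      Prf T
        (.and hκ
          (.conj (Σ s, W s) hW fun w => .eq (.var (x w.1 w.2)) (.var (y w.1 w.2)))
          (φ.rename fun s => Sum.elim _root_.id (x s)))
        (φ.rename fun s => Sum.elim _root_.id (y s))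
  | conj_elim {Γ : Ctx L.Sorts} (hΓ : IsSmallCtx κ Γ) {ι : Type u} (hι : #ι < κ)
      (φ : ι → Fml L Γ) (j : ι) : Prf T (.conj ι hι φ) (φ j)
  | conj_intro {Γ : Ctx L.Sorts} (hΓ : IsSmallCtx κ Γ) {ι : Type u} (hι : #ι < κ)
      {φ : Fml L Γ} {ψ : ι → Fml L Γ} : (∀ i, Prf T φ (ψ i)) → Prf T φ (.conj ι hι ψ)
  | disj_intro {Γ : Ctx L.Sorts} (hΓ : IsSmallCtx κ Γ) {ι : Type u} (hι : #ι ≤ κ)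
      (φ : ι → Fml L Γ) (j : ι) : Prf T (φ j) (.disj ι hι φ)
  | disj_elim {Γ : Ctx L.Sorts} (hΓ : IsSmallCtx κ Γ) {ι : Type u} (hι : #ι ≤ κ)
      {φ : ι → Fml L Γ} {θ : Fml L Γ} : (∀ i, Prf T (φ i) θ) → Prf T (.disj ι hι φ) θ
  | ex_elim {Γ Y : Ctx L.Sorts} (hY : IsSmallCtx κ Y) {φ : Fml L (Γ.append Y)} {ψ : Fml L Γ} :
      Prf T φ (ψ.rename fun _ => Sum.inl) → Prf T (.ex Y hY φ) ψ
  | ex_intro {Γ Y : Ctx L.Sorts} (hY : IsSmallCtx κ Y) {φ : Fml L (Γ.append Y)} {ψ : Fml L Γ} :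
      Prf T (.ex Y hY φ) ψ → Prf T φ (ψ.rename fun _ => Sum.inl)
  /-- Transfinite transitivity, for the tree `G^{<κ}`, the node `f` carrying the formula `φ f` in
  the context `X f`, and `B` the set of minimal elements of the bar `D`. The variables that are
  added at a child `g` of `f` are those of `X g` that are not in `X f`; along a branch the contexts
  grow, and at a limit node no variable is added. -/
  | transfinite_transitivity (hκ : ℵ₀ ≤ κ) {G : Type u} (hG : #G ≤ κ) {V : Ctx L.Sorts}
      (X : Node κ G → ∀ s, Set (V s))
      (hX : ∀ f, IsSmallCtx κ (toCtx (X f)))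
      (hmono : ∀ f g, f ≤ g → ∀ s, X f s ⊆ X g s)
      (hlimit : ∀ f : Node κ G, Order.IsSuccLimit f.level → ∀ s, X f s = ⋃ h : f.Pred, X h.1 s)
      (φ : ∀ f, Fml L (toCtx (X f)))
      (D : Set (Node κ G)) (hD : Node.IsBar D) (hB : #(Node.MinNode D) ≤ κ)
      (r : Node κ G) (hr : IsMin r.level) :
      (∀ f : Node κ G, Prf T (φ f)
        (.disj {g : Node κ G // f.IsChild g} (f.mk_children_le hG) fun g =>
          (φ g.1).exNew (X f) (hX g.1))) →
      (∀ f : Node κ G, Order.IsSuccLimit f.level → Prf T (φ f)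
        (.conj f.Pred f.mk_pred_lt fun h => (φ h.1).weaken (hmono h.1 f h.2.1))) →
      (∀ f : Node κ G, Order.IsSuccLimit f.level → Prf T
        (.conj f.Pred f.mk_pred_lt fun h => (φ h.1).weaken (hmono h.1 f h.2.1)) (φ f)) →
      Prf T (φ r)
        (.disj (Node.MinNode D) hB fun f =>
          Fml.exNew (X r) (hX f.1)
            (.conj f.1.SuccPred (f.1.mk_succPred_lt hκ) fun h =>
              (φ h.1).weaken (hmono h.1 f.1 h.2.1)))

/-- The sequent `σ` is derivable from `T`. -/
def Provable (T : Set (Sequent L)) (σ : Sequent L) : Prop := Prf T σ.lhs σ.rhs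

/-! ### Set-valued models -/

/-- A set-valued structure. Sorts may be interpreted by the empty set. -/
structure Str (L : Signature κ) where
  carrier : L.Sorts → Type u
  func : ∀ f : L.Func, (∀ s, L.dom f s → carrier s) → carrier (L.cod f)
  rel : ∀ R : L.Rel, (∀ s, L.arity R s → carrier s) → Prop

/-- The value of a term under an assignment. -/
def Term.eval (M : Str L) {Γ : Ctx L.Sorts} (v : ∀ s, Γ s → M.carrier s) :
    ∀ {s : L.Sorts}, Term L Γ s → M.carrier s
  | _, .var x => v _ x
  | _, .app f t => M.func f fun s i => (t s i).eval M v

/-- Satisfaction of a formula under an assignment of its context. -/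
def Fml.Sat (M : Str L) : ∀ {Γ : Ctx L.Sorts}, Fml L Γ → (∀ s, Γ s → M.carrier s) → Prop
  | _, .eq t t', v => t.eval M v = t'.eval M v
  | _, .rel R t, v => M.rel R fun s i => (t s i).eval M v
  | _, .conj _ _ φ, v => ∀ i, (φ i).Sat M v
  | _, .disj _ _ φ, v => ∃ i, (φ i).Sat M v
  | _, .ex Y _ φ, v => ∃ w : ∀ s, Y s → M.carrier s, φ.Sat M fun s => Sum.elim (v s) (w s)

/-- The sequent `σ` holds in `M`. -/
def Str.Models (M : Str L) (σ : Sequent L) : Prop :=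
  ∀ v : ∀ s, σ.ctx s → M.carrier s, σ.lhs.Sat M v → σ.rhs.Sat M v

end InfLogic

/-!
The proof is a Henkin construction along the branches of a tree, with transfinite transitivity in
the place of Zorn's lemma.

A *stage* (`Stage`) is a small set of variables from a fixed pool together with a formula in these
variables. Suppose that a stage is known to imply a disjunction, or an existential formula. Then it
has at most `κ` extensions, in which one of the disjuncts has been added or fresh variables have
been added as witnesses, and the stage implies the disjunction of these extensions, with the new
variables quantified (`Stage.exists_step`). For this the side formula has to be carried into the
disjuncts, so that Frobenius reciprocity and distributivity are needed. Neither is a rule of the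
system, but both follow from transfinite transitivity for a suitable tree (`Prf.of_disj_exNew`).

The *requirements* are the disjunctions and existential formulas that occur in `T` and in the sequent
`σ`, the formulas `∃ y, f x = y` for the function symbols that occur there, and `∃ y, ⊤` for the
sorts of the variables that occur there. Since `κ ^< κ = κ`, there are at most `κ` of them even after
their free variables have been named by variables of the pool, and they can be listed in type `κ`
with each recurring cofinally often. Processing them in this order, starting with the left hand side
of `σ`, gives a tree of stages of height `κ` (`Stage.atNode`), with unions and conjunctions taken at
limits.

If every branch had a stage that implies the right hand side of `σ`, then transfinite transitivity
would derive `σ` (`Prf.of_bar`, `Stage.forces_of_bar`). So if `σ` is not derivable there is a branch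
on which its right hand side is never known (`exists_branch`). The variables on this branch, modulo
known equality, form a model with carriers of at most `κ` elements (`Branch.model`). By regularity
of `κ`, fewer than `κ` known facts are known at a common stage, and so a formula whose requirements
are met is true in the model if and only if it is eventually known (`Branch.sat_iff`). Hence the model
satisfies `T` and refutes `σ`.

The signature may have more than `κ` symbols. A symbol that does not occur in `T` or `σ` is
interpreted arbitrarily. The only obstruction could be a function symbol with inhabited argument
sorts and empty value sort. It is excluded by letting a sort be inhabited as soon as some stage has
a term of that sort (`Branch.Carrier`, `Branch.nonempty_cod`); the requirements `∃ y, ⊤` ensure that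
in a sort that matters for the truth lemma there are then only named elements
(`Branch.nonempty_elem`, `Branch.exists_names`).
-/

namespace InfLogic

universe v w

variable {κ : Cardinal.{u}} {L : Signature κ}

/-! ### Substitution -/

theorem Term.subst_subst {Γ Δ Θ : Ctx L.Sorts} (σ : ∀ s, Γ s → Term L Δ s)
    (τ : ∀ s, Δ s → Term L Θ s) {s : L.Sorts} (t : Term L Γ s) :
    (t.subst σ).subst τ = t.subst fun s x => (σ s x).subst τ := by
  induction t with
  | var x => simp only [Term.subst]
  | app f t ih => simp only [Term.subst, ih]

theorem Term.subst_var {Γ : Ctx L.Sorts} {s : L.Sorts} (t : Term L Γ s) :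
    t.subst (fun _ x => .var x) = t := by
  induction t with
  | var x => simp only [Term.subst]
  | app f t ih => simp only [Term.subst, ih]

theorem Fml.subst_subst {Γ Δ Θ : Ctx L.Sorts} (φ : Fml L Γ) (σ : ∀ s, Γ s → Term L Δ s)
    (τ : ∀ s, Δ s → Term L Θ s) :
    (φ.subst σ).subst τ = φ.subst fun s x => (σ s x).subst τ := by
  induction φ generalizing Δ Θ with
  | eq t t' => simp only [Fml.subst, Term.subst_subst]
  | rel R t => simp only [Fml.subst, Term.subst_subst]
  | conj ι hι φ ih => simp only [Fml.subst, ih]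
  | disj ι hι φ ih => simp only [Fml.subst, ih]
  | ex Y hY φ ih =>
    simp only [Fml.subst, ih]
    congr 2
    funext s x
    rcases x with x | y
    · simp only [liftSubst, Term.subst_subst, Term.subst]
    · simp only [liftSubst, Term.subst]

theorem Fml.subst_var {Γ : Ctx L.Sorts} (φ : Fml L Γ) : φ.subst (fun _ x => .var x) = φ := by
  induction φ with
  | eq t t' => simp only [Fml.subst, Term.subst_var]
  | rel R t => simp only [Fml.subst, Term.subst_var]
  | conj ι hι φ ih => simp only [Fml.subst, ih]
  | disj ι hι φ ih => simp only [Fml.subst, ih]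
  | ex Y hY φ ih =>
    simp only [Fml.subst]
    congr 1
    convert ih using 2
    funext s x
    rcases x with x | y <;> simp only [liftSubst, Term.subst]

theorem Fml.subst_rename {Γ Δ Θ : Ctx L.Sorts} (φ : Fml L Γ) (ρ : ∀ s, Γ s → Δ s)
    (σ : ∀ s, Δ s → Term L Θ s) : (φ.rename ρ).subst σ = φ.subst fun s x => σ s (ρ s x) := by
  simp only [Fml.rename, Fml.subst_subst, Term.subst]

theorem Fml.rename_rename {Γ Δ Θ : Ctx L.Sorts} (φ : Fml L Γ) (ρ : ∀ s, Γ s → Δ s)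
    (ρ' : ∀ s, Δ s → Θ s) : (φ.rename ρ).rename ρ' = φ.rename fun s x => ρ' s (ρ s x) := by
  simp only [Fml.rename, Fml.subst_subst, Term.subst]

theorem Fml.rename_id {Γ : Ctx L.Sorts} (φ : Fml L Γ) : φ.rename (fun _ x => x) = φ :=
  φ.subst_var

/-- Renaming under a quantifier, with the bound variables kept. -/
theorem Fml.rename_ex {Γ Δ Y : Ctx L.Sorts} (hY : IsSmallCtx κ Y) (φ : Fml L (Γ.append Y))
    (ρ : ∀ s, Γ s → Δ s) :
    (Fml.ex Y hY φ).rename ρ =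
      .ex Y hY (φ.rename fun s => Sum.elim (fun x => .inl (ρ s x)) fun y => .inr y) := by
  simp only [Fml.rename, Fml.subst]
  congr 2
  funext s x
  rcases x with x | y <;> simp only [liftSubst, Term.subst, Sum.elim_inl, Sum.elim_inr]

theorem Fml.rename_conj {Γ Δ : Ctx L.Sorts} (ι : Type u) (hι : #ι < κ) (φ : ι → Fml L Γ)
    (ρ : ∀ s, Γ s → Δ s) :
    (Fml.conj ι hι φ).rename ρ = .conj ι hι fun i => (φ i).rename ρ := rfl

theorem Fml.subst_and (hκ : ℵ₀ ≤ κ) {Γ Δ : Ctx L.Sorts} (φ ψ : Fml L Γ)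
    (σ : ∀ s, Γ s → Term L Δ s) :
    (Fml.and hκ φ ψ).subst σ = .and hκ (φ.subst σ) (ψ.subst σ) := by
  simp only [Fml.and, Fml.subst]
  congr 1
  funext b
  rcases b with ⟨_ | _⟩ <;> rfl

theorem Fml.rename_and (hκ : ℵ₀ ≤ κ) {Γ Δ : Ctx L.Sorts} (φ ψ : Fml L Γ) (ρ : ∀ s, Γ s → Δ s) :
    (Fml.and hκ φ ψ).rename ρ = .and hκ (φ.rename ρ) (ψ.rename ρ) :=
  subst_and hκ φ ψ _

theorem Fml.subst_top (hκ : ℵ₀ ≤ κ) {Γ Δ : Ctx L.Sorts} (σ : ∀ s, Γ s → Term L Δ s) :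
    (Fml.top hκ : Fml L Γ).subst σ = .top hκ := by
  simp only [Fml.top, Fml.subst]
  congr 1
  funext b
  exact b.elim

theorem Fml.weaken_rename {V Δ : Ctx L.Sorts} {X X' : ∀ s, Set (V s)} (h : ∀ s, X s ⊆ X' s)
    (φ : Fml L Δ) (ρ : ∀ s, Δ s → toCtx X s) :
    (φ.rename ρ).weaken h = φ.rename fun s x => Set.inclusion (h s) (ρ s x) :=
  φ.rename_rename _ _

theorem Fml.weaken_weaken {V : Ctx L.Sorts} {X X' X'' : ∀ s, Set (V s)} (h : ∀ s, X s ⊆ X' s)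
    (h' : ∀ s, X' s ⊆ X'' s) (φ : Fml L (toCtx X)) :
    (φ.weaken h).weaken h' = φ.weaken fun s => (h s).trans (h' s) :=
  φ.rename_rename _ _

theorem Fml.weaken_refl {V : Ctx L.Sorts} {X : ∀ s, Set (V s)} (h : ∀ s, X s ⊆ X s)
    (φ : Fml L (toCtx X)) : φ.weaken h = φ :=
  φ.rename_id

/-! ### Small contexts -/

theorem IsSmallCtx.of_surjective {S : Type u} {Γ Δ : Ctx S} (h : IsSmallCtx κ Γ)
    (f : ∀ s, Γ s → Δ s) (hf : ∀ s, Function.Surjective (f s)) : IsSmallCtx κ Δ :=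
  (mk_le_of_surjective (f := Sigma.map _root_.id f)
    (Function.Surjective.sigma_map Function.surjective_id hf)).trans_lt h

theorem IsSmallCtx.append (hκ : ℵ₀ ≤ κ) {S : Type u} {Γ Y : Ctx S} (hΓ : IsSmallCtx κ Γ)
    (hY : IsSmallCtx κ Y) : IsSmallCtx κ (Γ.append Y) := by
  unfold IsSmallCtx at *
  rw [mk_congr (Equiv.sigmaSumDistrib Γ Y), mk_sum, lift_id, lift_id]
  exact add_lt_of_lt hκ hΓ hY

theorem IsSmallCtx.mk_lt {S : Type u} {Γ : Ctx S} (hΓ : IsSmallCtx κ Γ) (s : S) : #(Γ s) < κ :=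
  (mk_le_of_injective (f := fun x => (⟨s, x⟩ : Σ s, Γ s)) sigma_mk_injective).trans_lt hΓ

theorem IsSmallCtx.union (hκ : ℵ₀ ≤ κ) {S : Type u} {V : Ctx S} {X Y : ∀ s, Set (V s)}
    (hX : IsSmallCtx κ (toCtx X)) (hY : IsSmallCtx κ (toCtx Y)) :
    IsSmallCtx κ (toCtx fun s => X s ∪ Y s) := by
  refine (hX.append hκ hY).of_surjective
    (fun s => Sum.elim (fun x => ⟨x.1, .inl x.2⟩) fun y => ⟨y.1, .inr y.2⟩) fun s => ?_
  rintro ⟨x, hx | hx⟩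
  · exact ⟨.inl ⟨x, hx⟩, rfl⟩
  · exact ⟨.inr ⟨x, hx⟩, rfl⟩

theorem IsSmallCtx.range {S : Type u} {V Γ : Ctx S} (hΓ : IsSmallCtx κ Γ) (ρ : ∀ s, Γ s → V s) :
    IsSmallCtx κ (toCtx fun s => Set.range (ρ s)) :=
  hΓ.of_surjective (fun s => Set.rangeFactorization (ρ s)) fun _ => Set.rangeFactorization_surjective

theorem IsSmallCtx.iUnion (hreg : κ.IsRegular) {S : Type u} {V : Ctx S} {ι : Type u} (hι : #ι < κ)
    {X : ι → ∀ s, Set (V s)} (hX : ∀ i, IsSmallCtx κ (toCtx (X i))) :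
    IsSmallCtx κ (toCtx fun s => ⋃ i, X i s) := by
  have h : #(Σ i, Σ s, X i s) < κ := by
    rw [mk_sigma]
    exact sum_lt_of_isRegular hreg hι hX
  refine (mk_le_of_surjective (f := fun p : (Σ i, Σ s, X i s) =>
    (⟨p.2.1, p.2.2.1, Set.mem_iUnion.2 ⟨p.1, p.2.2.2⟩⟩ : Σ s, toCtx (fun s => ⋃ i, X i s) s))
    ?_).trans_lt h
  rintro ⟨s, x, hx⟩
  obtain ⟨i, hi⟩ := Set.mem_iUnion.1 hx
  exact ⟨⟨i, s, x, hi⟩, rfl⟩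

theorem nonempty_toType_ord (hκ : ℵ₀ ≤ κ) : Nonempty κ.ord.ToType := by
  rw [← mk_ne_zero_iff, mk_ord_toType]
  exact (aleph0_pos.trans_le hκ).ne'

theorem isSmallCtx_empty (hκ : ℵ₀ ≤ κ) {S : Type u} : IsSmallCtx κ (fun _ : S => PEmpty.{u + 1}) := by
  unfold IsSmallCtx
  rw [mk_eq_zero_iff.2 ⟨fun x => x.2.elim⟩]
  exact aleph0_pos.trans_le hκ

/-- The context consisting of one variable, of sort `s`. -/
abbrev Ctx.single {S : Type u} (s : S) : Ctx S := fun s' => {_x : PUnit.{u + 1} // s' = s}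

theorem isSmallCtx_single (hκ : ℵ₀ ≤ κ) {S : Type u} (s : S) : IsSmallCtx κ (Ctx.single s) := by
  refine lt_of_le_of_lt ?_ (one_lt_aleph0.trans_le hκ)
  rw [le_one_iff_subsingleton]
  constructor
  rintro ⟨s₁, ⟨⟩, rfl⟩ ⟨s₂, ⟨⟩, rfl⟩
  rfl

/-! ### Derived rules -/

variable {T : Set (Sequent L)}

namespace Prf

variable {Γ : Ctx L.Sorts}

theorem rename {Δ : Ctx L.Sorts} (hΔ : IsSmallCtx κ Δ) (ρ : ∀ s, Γ s → Δ s) {φ ψ : Fml L Γ}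
    (h : Prf T φ ψ) : Prf T (φ.rename ρ) (ψ.rename ρ) :=
  h.subst hΔ _

theorem weaken {V : Ctx L.Sorts} {X X' : ∀ s, Set (V s)} (hX' : IsSmallCtx κ (toCtx X'))
    (h : ∀ s, X s ⊆ X' s) {φ ψ : Fml L (toCtx X)} (hp : Prf T φ ψ) :
    Prf T (φ.weaken h) (ψ.weaken h) :=
  hp.rename hX' _

theorem top_intro (hκ : ℵ₀ ≤ κ) (hΓ : IsSmallCtx κ Γ) (φ : Fml L Γ) : Prf T φ (.top hκ) :=
  conj_intro hΓ _ fun i => i.elim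

theorem and_intro (hκ : ℵ₀ ≤ κ) (hΓ : IsSmallCtx κ Γ) {φ ψ θ : Fml L Γ} (h : Prf T θ φ)
    (h' : Prf T θ ψ) : Prf T θ (.and hκ φ ψ) :=
  conj_intro hΓ _ fun i => by rcases i with ⟨_ | _⟩ <;> assumption

theorem and_left (hκ : ℵ₀ ≤ κ) (hΓ : IsSmallCtx κ Γ) (φ ψ : Fml L Γ) :
    Prf T (.and hκ φ ψ) φ :=
  conj_elim hΓ _ (fun b : ULift Bool => cond b.down φ ψ) ⟨true⟩

theorem and_right (hκ : ℵ₀ ≤ κ) (hΓ : IsSmallCtx κ Γ) (φ ψ : Fml L Γ) :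
    Prf T (.and hκ φ ψ) ψ :=
  conj_elim hΓ _ (fun b : ULift Bool => cond b.down φ ψ) ⟨false⟩

theorem disj_mono (hΓ : IsSmallCtx κ Γ) {ι ι' : Type u} (hι : #ι ≤ κ) (hι' : #ι' ≤ κ)
    {φ : ι → Fml L Γ} {ψ : ι' → Fml L Γ} (h : ∀ i, ∃ j, Prf T (φ i) (ψ j)) :
    Prf T (.disj ι hι φ) (.disj ι' hι' ψ) :=
  disj_elim hΓ _ fun i => (h i).choose_spec.cut (disj_intro hΓ _ _ _)

/-- An instance `φ[t/y]` implies `∃ y, φ`. -/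
theorem ex_of_subst (hΓ : IsSmallCtx κ Γ) {Y : Ctx L.Sorts} (hY : IsSmallCtx κ Y)
    (t : ∀ s, Y s → Term L Γ s) (φ : Fml L (Γ.append Y)) :
    Prf T (φ.subst fun s => Sum.elim (fun x => .var x) (t s)) (.ex Y hY φ) := by
  have h := ex_intro (T := T) hY (id hΓ (.ex Y hY φ))
  have h2 := h.subst hΓ fun s => Sum.elim (fun x => .var x) (t s)
  rw [Fml.subst_rename] at h2
  simpa only [Sum.elim_inl, Fml.subst_var] using h2

/-- Provability is reflected by an invertible renaming. -/
theorem of_rename {Δ : Ctx L.Sorts} (hΓ : IsSmallCtx κ Γ) (ρ : ∀ s, Γ s → Δ s)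
    (ρ' : ∀ s, Δ s → Γ s) (hρ : ∀ s x, ρ' s (ρ s x) = x) {φ ψ : Fml L Γ}
    (h : Prf T (φ.rename ρ) (ψ.rename ρ)) : Prf T φ ψ := by
  simpa only [Fml.rename_rename, hρ, Fml.rename_id] using h.rename hΓ ρ'

end Prf

/-! ### Quantification over the new variables -/

theorem splitVars_of_mem {S : Type u} {V : Ctx S} {X X' : ∀ s, Set (V s)} {s : S}
    (v : toCtx X' s) (h : v.1 ∈ X s) : splitVars X X' s v = .inl ⟨v.1, h⟩ := by
  simp [splitVars, h]

theorem sumElim_splitVars {S : Type u} {V : Ctx S} {X X' : ∀ s, Set (V s)}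
    (h : ∀ s, X s ⊆ X' s) (s : S) (v : toCtx X' s) :
    Sum.elim (Set.inclusion (h s)) (fun y : toCtx (newVars X X') s => ⟨y.1, y.2.1⟩)
      (splitVars X X' s v) = v := by
  unfold splitVars
  split_ifs <;> rfl

namespace Prf

variable {V : Ctx L.Sorts} {X X' X'' : ∀ s, Set (V s)}

/-- The quantifier over the new variables is left adjoint to weakening: elimination. -/
theorem exNew_elim (hκ : ℵ₀ ≤ κ) (hX : IsSmallCtx κ (toCtx X)) (hX' : IsSmallCtx κ (toCtx X'))
    (h : ∀ s, X s ⊆ X' s) {φ : Fml L (toCtx X')} {ψ : Fml L (toCtx X)}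
    (hp : Prf T φ (ψ.weaken h)) : Prf T (φ.exNew X hX') ψ := by
  refine ex_elim _ ?_
  have := hp.rename (hX.append hκ (isSmallCtx_newVars (X := X) hX')) (splitVars X X')
  rw [Fml.weaken, Fml.rename_rename] at this
  convert this using 2
  funext s x
  exact (splitVars_of_mem (Set.inclusion (h s) x) x.2).symm

/-- The quantifier over the new variables is left adjoint to weakening: introduction. -/
theorem exNew_intro (hX : IsSmallCtx κ (toCtx X)) (hX' : IsSmallCtx κ (toCtx X'))
    (h : ∀ s, X s ⊆ X' s) (φ : Fml L (toCtx X')) :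
    Prf T φ ((φ.exNew X hX').weaken h) := by
  have := (ex_intro (T := T) (isSmallCtx_newVars (X := X) hX')
    (id hX (φ.exNew X hX'))).rename hX' fun s => Sum.elim (Set.inclusion (h s))
      (fun y : toCtx (newVars X X') s => ⟨y.1, y.2.1⟩)
  rw [Fml.rename_rename, Fml.rename_rename] at this
  simp only [sumElim_splitVars, Fml.rename_id] at this
  exact this

theorem exNew_mono (hκ : ℵ₀ ≤ κ) (hX : IsSmallCtx κ (toCtx X)) (hX' : IsSmallCtx κ (toCtx X'))
    (hX'' : IsSmallCtx κ (toCtx X'')) (h : ∀ s, X s ⊆ X'' s) (h' : ∀ s, X'' s ⊆ X' s)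
    {φ : Fml L (toCtx X')} {ψ : Fml L (toCtx X'')} (hp : Prf T φ (ψ.weaken h')) :
    Prf T (φ.exNew X hX') (ψ.exNew X hX'') := by
  refine exNew_elim hκ hX hX' (fun s => (h s).trans (h' s)) (hp.cut ?_)
  rw [← Fml.weaken_weaken h h']
  exact (exNew_intro hX hX'' h ψ).weaken hX' h'

/-- The variables bound by a quantifier may be taken from the pool. -/
theorem exNew_of_ex (hκ : ℵ₀ ≤ κ) (hX : IsSmallCtx κ (toCtx X)) (hX' : IsSmallCtx κ (toCtx X'))
    (h : ∀ s, X s ⊆ X' s) {Y : Ctx L.Sorts} (hY : IsSmallCtx κ Y)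
    (j : ∀ s, (toCtx X).append Y s → toCtx X' s) (hj : ∀ s, Function.Bijective (j s))
    (hinl : ∀ s x, j s (.inl x) = Set.inclusion (h s) x) (φ : Fml L ((toCtx X).append Y)) :
    Prf T (.ex Y hY φ) ((φ.rename j).exNew X hX') := by
  refine ex_elim _ ?_
  have := (exNew_intro (T := T) hX hX' h (φ.rename j)).rename (hX.append hκ hY)
    fun s => (Equiv.ofBijective _ (hj s)).symm
  simp only [Fml.weaken, Fml.rename_rename, Equiv.ofBijective_symm_apply_apply, Fml.rename_id,
    ← hinl] at this
  exact this

end Prf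

/-! ### Nodes -/

namespace Node

variable {G : Type u}

theorem le_rfl {f : Node κ G} : f ≤ f := ⟨_root_.le_rfl, fun _ => rfl⟩

theorem le_trans {f g h : Node κ G} (hfg : f ≤ g) (hgh : g ≤ h) : f ≤ h :=
  ⟨hfg.1.trans hgh.1, fun i => (hfg.2 i).trans (hgh.2 ⟨i, i.2.trans_le hfg.1⟩)⟩

theorem le_of_isMin {r : Node κ G} (hr : IsMin r.level) (f : Node κ G) : r ≤ f :=
  ⟨hr.isBot _, fun i => (hr.not_lt i.2).elim⟩

/-- The restriction of a node to a smaller length. -/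
def restrict (f : Node κ G) {a : κ.ord.ToType} (h : a ≤ f.level) : Node κ G :=
  ⟨a, fun i => f.val ⟨i, i.2.trans_le h⟩⟩

theorem restrict_le (f : Node κ G) {a : κ.ord.ToType} (h : a ≤ f.level) : f.restrict h ≤ f :=
  ⟨h, fun _ => rfl⟩

open Classical in
/-- The immediate successor of `f` with last entry `i`. -/
noncomputable def snoc (f : Node κ G) (i : G) : Node κ G :=
  ⟨Order.succ f.level, fun j => if h : j < f.level then f.val ⟨j, h⟩ else i⟩

theorem le_snoc (f : Node κ G) (i : G) : f ≤ f.snoc i :=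
  ⟨Order.le_succ _, fun j => by simp [snoc, show j.1 < f.level from j.2]⟩

theorem isChild_snoc (hκ : ℵ₀ ≤ κ) (f : Node κ G) (i : G) : f.IsChild (f.snoc i) :=
  have := noMaxOrder hκ
  ⟨f.le_snoc i, Order.covBy_succ _⟩

theorem snoc_val (f : Node κ G) (i : G) {a : κ.ord.ToType} (ha : f.level = a)
    (h : a < (f.snoc i).level) : (f.snoc i).val ⟨a, h⟩ = i := by
  subst ha
  simp [snoc]

theorem mk_le (hκ : ℵ₀ ≤ κ) (hpow : κ ^< κ = κ) (hG : #G ≤ κ) : #(Node κ G) ≤ κ := by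
  have h : #(Node κ G) ≤ #(Σ a : κ.ord.ToType, (Set.Iio a → G)) :=
    mk_le_of_injective (f := fun f => ⟨f.level, f.val⟩) <| by
      rintro ⟨a, f⟩ ⟨b, g⟩ h
      simp only [Sigma.mk.injEq] at h
      obtain ⟨rfl, h⟩ := h
      rw [eq_of_heq h]
  refine h.trans ?_
  rw [mk_sigma]
  refine (sum_le_sum _ (fun _ => κ) fun a => ?_).trans ?_
  · rw [← power_def]
    refine (power_le_power_right hG).trans ?_
    conv_rhs => rw [← hpow]
    exact le_powerlt _ (by simpa using mk_Iio_lt a (by simp))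
  · simp [mul_eq_self hκ]

end Node

/-! ### Bars -/

section Bar

variable {G : Type u} {V : Ctx L.Sorts} (X : Node κ G → ∀ s, Set (V s))
  (hmono : ∀ f g, f ≤ g → ∀ s, X f s ⊆ X g s) (φ : ∀ f, Fml L (toCtx (X f)))

/-- The conjunction of the formulas at the nodes of successor level below `f`. -/
def pathConj (hκ : ℵ₀ ≤ κ) (f : Node κ G) : Fml L (toCtx (X f)) :=
  .conj f.SuccPred (f.mk_succPred_lt hκ) fun h => (φ h.1).weaken (hmono h.1 f h.2.1)

theorem Prf.pathConj_elim (hκ : ℵ₀ ≤ κ) (hX : ∀ f, IsSmallCtx κ (toCtx (X f)))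
    {f h : Node κ G} (hf : h ≤ f) (hh : ∃ β, β ⋖ h.level) :
    Prf T (pathConj X hmono φ hκ f) ((φ h).weaken (hmono h f hf)) :=
  Prf.conj_elim (hX f) _
    (fun h : f.SuccPred => (φ h.1).weaken (hmono h.1 f h.2.1)) ⟨h, hf, hh⟩

/-- Transfinite transitivity as a reasoning principle: if along every branch the accumulated
formulas eventually imply `ψ`, then the formula at the root implies `ψ`. -/
theorem Prf.of_bar (hκ : ℵ₀ ≤ κ) (hpow : κ ^< κ = κ) (hG : #G ≤ κ)
    (hX : ∀ f, IsSmallCtx κ (toCtx (X f)))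
    (hlimit : ∀ f : Node κ G, Order.IsSuccLimit f.level → ∀ s, X f s = ⋃ h : f.Pred, X h.1 s)
    (r : Node κ G) (hr : IsMin r.level)
    (hsucc : ∀ f : Node κ G, Prf T (φ f)
      (.disj {g : Node κ G // f.IsChild g} (f.mk_children_le hG) fun g =>
        (φ g.1).exNew (X f) (hX g.1)))
    (hlim₁ : ∀ f : Node κ G, Order.IsSuccLimit f.level → Prf T (φ f)
      (.conj f.Pred f.mk_pred_lt fun h => (φ h.1).weaken (hmono h.1 f h.2.1)))
    (hlim₂ : ∀ f : Node κ G, Order.IsSuccLimit f.level → Prf T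
      (.conj f.Pred f.mk_pred_lt fun h => (φ h.1).weaken (hmono h.1 f h.2.1)) (φ f))
    (ψ : Fml L (toCtx (X r)))
    (hbar : ∀ b : κ.ord.ToType → G, ∃ β, Prf T (pathConj X hmono φ hκ (Node.ofBranch b β))
      (ψ.weaken (hmono r _ (Node.le_of_isMin hr _)))) : Prf T (φ r) ψ := by
  let D : Set (Node κ G) := {f | Prf T (pathConj X hmono φ hκ f)
    (ψ.weaken (hmono r f (Node.le_of_isMin hr f)))}
  have hD : Node.IsBar D := by
    refine ⟨fun f g hfg (hf : Prf T _ _) => ?_, hbar⟩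
    have h1 := hf.weaken (hX g) (hmono f g hfg)
    rw [Fml.weaken_weaken] at h1
    refine Prf.cut (Prf.conj_intro (hX g) _ fun h => ?_) h1
    have := Prf.pathConj_elim (T := T) X hmono φ hκ hX (Node.le_trans h.2.1 hfg) h.2.2
    rwa [← Fml.weaken_weaken (hmono h.1 f h.2.1) (hmono f g hfg)] at this
  have hB : #(Node.MinNode D) ≤ κ := (mk_subtype_le _).trans (Node.mk_le hκ hpow hG)
  refine (Prf.transfinite_transitivity hκ hG X hX hmono hlimit φ D hD hB r hr hsucc hlim₁
    hlim₂).cut (Prf.disj_elim (hX r) _ fun f => ?_)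
  exact Prf.exNew_elim hκ (hX r) (hX f.1) (hmono r f.1 (Node.le_of_isMin hr _)) f.2.prop

end Bar

/-! ### Frobenius reciprocity and distributivity -/

section Frobenius

variable {ι : Type u}

open Classical in
/-- A label for the nodes of the tree `ι^{<κ}`: `none` up to the level `a`; above it, the entry of
the node at `a`, together with whether some limit level has been reached. -/
noncomputable def frobLabel (a : κ.ord.ToType) (f : Node κ ι) : Option (ι × Prop) :=
  if h : a < f.level then some (f.val ⟨a, h⟩, ∃ l ≤ f.level, Order.IsSuccLimit l) else none

theorem frobLabel_of_le {a : κ.ord.ToType} {f : Node κ ι} (h : f.level ≤ a) :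
    frobLabel a f = none := by
  simp [frobLabel, h]

theorem frobLabel_of_lt {a : κ.ord.ToType} {f : Node κ ι} (h : a < f.level) :
    frobLabel a f = some (f.val ⟨a, h⟩, ∃ l ≤ f.level, Order.IsSuccLimit l) := by
  simp [frobLabel, h]

variable {V : Ctx L.Sorts} (X₀ : ∀ s, Set (V s)) (X : ι → ∀ s, Set (V s))

/-- The context of a label. -/
def frobCtx : Option (ι × Prop) → ∀ s, Set (V s)
  | none => X₀
  | some p => X p.1

open Classical in
/-- The formula of a label: `φ` at first, then `ψ i`, and `φ ∧ ψ i` from the first limit level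
on, as the rule demands at limits. -/
noncomputable def frobFml (hκ : ℵ₀ ≤ κ) (h : ∀ i s, X₀ s ⊆ X i s) (φ : Fml L (toCtx X₀))
    (ψ : ∀ i, Fml L (toCtx (X i))) : ∀ o : Option (ι × Prop), Fml L (toCtx (frobCtx X₀ X o))
  | none => φ
  | some p => if p.2 then .and hκ (φ.weaken (h p.1)) (ψ p.1) else ψ p.1

/-- Disjunction elimination with existential quantifiers and with the side formula `φ`. Both
Frobenius reciprocity and the distributivity of `∧` over `⋁` are instances; neither is a rule of
the system, and both come from transfinite transitivity for a tree that first repeats `φ`, then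
branches over the disjuncts and then, up to the adjustment at limits, stays constant. -/
theorem Prf.of_disj_exNew (hκ : ℵ₀ ≤ κ) (hpow : κ ^< κ = κ) (hι : #ι ≤ κ)
    (hX₀ : IsSmallCtx κ (toCtx X₀)) (hX : ∀ i, IsSmallCtx κ (toCtx (X i)))
    (h : ∀ i s, X₀ s ⊆ X i s) (φ θ : Fml L (toCtx X₀)) (ψ : ∀ i, Fml L (toCtx (X i)))
    (hp : Prf T φ (.disj ι hι fun i => (ψ i).exNew X₀ (hX i)))
    (hθ : ∀ i, Prf T (.and hκ (φ.weaken (h i)) (ψ i)) (θ.weaken (h i))) : Prf T φ θ := by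
  have := noMaxOrder hκ
  rcases isEmpty_or_nonempty ι with hemp | ⟨⟨i₀⟩⟩
  · exact hp.cut (disj_elim hX₀ _ fun i => hemp.elim i)
  have := nonempty_toType_ord hκ
  obtain ⟨z, hz⟩ : ∃ z : κ.ord.ToType, IsBot z := by
    obtain ⟨z, -, hz⟩ := (wellFounded_lt (α := κ.ord.ToType)).has_min _ Set.univ_nonempty
    exact ⟨z, fun a => not_lt.1 (hz a trivial)⟩
  set a := Order.succ z
  have hza : z < a := Order.lt_succ z
  let lab : Node κ ι → Option (ι × Prop) := frobLabel a
  let Xl := frobCtx X₀ X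
  let φl := frobFml X₀ X hκ h φ ψ
  have hXl : ∀ o, IsSmallCtx κ (toCtx (Xl o)) := by
    rintro (_ | p)
    exacts [hX₀, hX _]
  have lim_lt : ∀ l : κ.ord.ToType, Order.IsSuccLimit l → a < l := fun l hl =>
    hl.succ_lt (lt_of_le_of_ne (hz l) fun e => hl.not_isMin (e ▸ hz.isMin))
  -- the labels of comparable nodes
  have hlab : ∀ f g : Node κ ι, f ≤ g →
      lab f = none ∨ ∃ i p q, lab f = some (i, p) ∧ lab g = some (i, q) := by
    intro f g hfg
    rcases le_or_gt f.level a with hf | hf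
    · exact .inl (frobLabel_of_le hf)
    · refine .inr ⟨_, _, ∃ l ≤ g.level, Order.IsSuccLimit l, frobLabel_of_lt hf, ?_⟩
      rw [hfg.2 ⟨a, hf⟩]
      exact frobLabel_of_lt (hf.trans_le hfg.1)
  have hmono : ∀ f g : Node κ ι, f ≤ g → ∀ s, Xl (lab f) s ⊆ Xl (lab g) s := by
    intro f g hfg s
    rcases hlab f g hfg with e | ⟨i, p, q, e, e'⟩
    · rw [e]
      rcases lab g with _ | p
      exacts [subset_rfl, h _ s]
    · rw [e, e']
      exact subset_rfl
  have hlim_lab : ∀ f : Node κ ι, Order.IsSuccLimit f.level → ∃ (i : ι) (p : Prop),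
      p ∧ lab f = some (i, p) := fun f hf =>
    ⟨_, _, ⟨_, le_rfl, hf⟩, frobLabel_of_lt (lim_lt _ hf)⟩
  have hnlim : ¬ ∃ l ≤ Order.succ a, Order.IsSuccLimit l := by
    rintro ⟨l, hl, hl'⟩
    exact absurd (hl'.succ_lt (lim_lt l hl')) (not_lt.2 hl)
  -- on the level after `a`, before any limit level, a node carries just a disjunct
  have hlab_two : ∀ f : Node κ ι, f.level = Order.succ a →
      ∃ (i : ι) (p : Prop), ¬ p ∧ lab f = some (i, p) := fun f hf =>
    ⟨_, _, by rw [hf]; exact hnlim, frobLabel_of_lt (by rw [hf]; exact Order.lt_succ a)⟩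
  have hr : IsMin (Node.mk (κ := κ) (G := ι) z fun _ => i₀).level := hz.isMin
  have hroot : lab ⟨z, fun _ => i₀⟩ = none := frobLabel_of_le hza.le
  have h0 : ∀ o s, X₀ s ⊆ Xl o s := by
    rintro (_ | p) s
    exacts [subset_rfl, h _ s]
  have fml_pos : ∀ (i : ι) (p : Prop), p →
      φl (some (i, p)) = (.and hκ (φ.weaken (h i)) (ψ i) : Fml L (toCtx (X i))) :=
    fun i p hp' => if_pos hp'
  have fml_neg : ∀ (i : ι) (p : Prop), ¬ p → φl (some (i, p)) = (ψ i : Fml L (toCtx (X i))) :=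
    fun i p hp' => if_neg hp'
  -- comparison of the formulas of two labels
  have weaken_of : ∀ o o' (hs : ∀ s, Xl o s ⊆ Xl o' s),
      (o = none ∧ (o' = none ∨ ∃ (i : ι) (p : Prop), p ∧ o' = some (i, p))) ∨
        (∃ (i : ι) (p q : Prop), o = some (i, q) ∧ o' = some (i, p) ∧ p) →
      Prf T (φl o') ((φl o).weaken hs) := by
    rintro _ _ hs (⟨rfl, rfl | ⟨i, p, hp', rfl⟩⟩ | ⟨i, p, q, rfl, rfl, hp'⟩)
    · exact (φ.weaken_refl hs).symm ▸ Prf.id hX₀ _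
    · rw [fml_pos i p hp']
      exact Prf.and_left hκ (hX i) _ _
    · refine (Fml.weaken_refl (X := X i) hs _).symm ▸ ?_
      by_cases hq : q
      · rw [fml_pos i p hp', fml_pos i q hq]
        exact Prf.id (hX i) _
      · rw [fml_pos i p hp', fml_neg i q hq]
        exact Prf.and_right hκ (hX i) _ _
  -- what implies `φ` and `ψ i` implies the formula of a limit node over them, and implies `θ`
  have join : ∀ o o' o'' (i : ι) (p q : Prop) (hs : ∀ s, Xl o s ⊆ Xl o'' s)
      (hs' : ∀ s, Xl o' s ⊆ Xl o'' s) (C : Fml L (toCtx (Xl o''))), o = none → ¬ q →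
      o' = some (i, q) → o'' = some (i, p) → Prf T C ((φl o).weaken hs) →
      Prf T C ((φl o').weaken hs') →
      (p → Prf T C (φl o'')) ∧ Prf T C (θ.weaken (h0 o'')) := by
    rintro _ _ _ i p q hs hs' C rfl hq rfl rfl h1 h2
    replace h2 := (Fml.weaken_refl (X := X i) hs' _) ▸ h2
    rw [fml_neg i q hq] at h2
    have h3 := Prf.and_intro hκ (hX i) h1 h2
    refine ⟨fun hp => ?_, h3.cut (hθ i)⟩
    rw [fml_pos i p hp]
    exact h3
  -- the premise at a successor where nothing happens
  have stay : ∀ o o', o = o' → Prf T (φl o) ((φl o').exNew (Xl o) (hXl o')) := by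
    rintro o _ rfl
    have := Prf.exNew_intro (T := T) (hXl o) (hXl o) (fun _ => subset_rfl) (φl o)
    rwa [Fml.weaken_refl] at this
  -- the premise at the level `a`, where the tree branches over the disjuncts
  have branch : ∀ o, o = none →
      Prf T (φl o) (.disj ι hι fun i => (ψ i).exNew (Xl o) (hX i)) := by
    rintro _ rfl
    exact hp
  have branch' : ∀ o o' (i : ι) (p : Prop), o' = some (i, p) → ¬ p →
      Prf T ((ψ i).exNew (Xl o) (hX i)) ((φl o').exNew (Xl o) (hXl o')) := by
    rintro o _ i p rfl hp'
    rw [fml_neg i p hp']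
    exact Prf.id (hXl o) _
  have main := Prf.of_bar (T := T) (fun f => Xl (lab f)) hmono (fun f => φl (lab f)) hκ hpow hι
    (fun f => hXl _) ?_ ⟨z, fun _ => i₀⟩ hr ?_ ?_ ?_ (θ.weaken (h0 _)) ?_
  · have root : ∀ o (h0 : ∀ s, X₀ s ⊆ Xl o s), o = none →
        Prf T (φl o) (θ.weaken h0) → Prf T φ θ := by
      rintro _ h0 rfl hh
      exact (θ.weaken_refl h0) ▸ hh
    exact root _ _ hroot main
  · intro f hf s
    refine subset_antisymm ?_ (Set.iUnion_subset fun e => hmono e.1 f e.2.1 s)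
    have hlt : Order.succ a < f.level := hf.succ_lt (lim_lt _ hf)
    obtain ⟨i, p, -, e⟩ := hlab_two (f.restrict hlt.le) rfl
    refine (?_ : _ ⊆ Xl (lab (f.restrict hlt.le)) s).trans (Set.subset_iUnion_of_subset
      (⟨f.restrict hlt.le, f.restrict_le _, hlt⟩ : f.Pred) subset_rfl)
    obtain e' | ⟨i', p', q, e', e''⟩ := hlab _ f (f.restrict_le hlt.le)
    · simp [e] at e'
    · rw [e', e'']
      exact subset_rfl
  · intro f
    rcases lt_trichotomy f.level a with hf | hf | hf
    · refine (stay _ (lab (f.snoc i₀)) ?_).cut (Prf.disj_intro (hXl _) _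
        (fun g : {g // f.IsChild g} => (φl (lab g.1)).exNew (Xl (lab f)) (hXl _)) (⟨f.snoc i₀, f.isChild_snoc hκ i₀⟩ : {g // f.IsChild g}))
      exact (frobLabel_of_le hf.le).trans (frobLabel_of_le (Order.succ_le_of_lt hf)).symm
    · refine (branch _ (frobLabel_of_le hf.le)).cut (Prf.disj_mono (hXl _) _ _ fun i => ?_)
      refine ⟨⟨f.snoc i, f.isChild_snoc hκ i⟩, ?_⟩
      have hlt : a < (f.snoc i).level := hf ▸ Order.lt_succ f.level
      refine branch' _ _ i (∃ l ≤ Order.succ a, Order.IsSuccLimit l)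
        ((frobLabel_of_lt hlt).trans ?_) hnlim
      rw [f.snoc_val i hf, ← hf]
      rfl
    · let i := f.val ⟨a, hf⟩
      refine (stay _ (lab (f.snoc i)) ?_).cut (Prf.disj_intro (hXl _) _
        (fun g : {g // f.IsChild g} => (φl (lab g.1)).exNew (Xl (lab f)) (hXl _)) (⟨f.snoc i, f.isChild_snoc hκ i⟩ : {g // f.IsChild g}))
      have hlt : a < (f.snoc i).level := hf.trans (Order.lt_succ _)
      refine (frobLabel_of_lt hf).trans (Eq.trans ?_ (frobLabel_of_lt hlt).symm)
      have hle := f.le_snoc i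
      rw [hle.2 ⟨a, hf⟩]
      congr 2
      refine propext ⟨fun ⟨l, hl, hl'⟩ => ⟨l, hl.trans hle.1, hl'⟩, fun ⟨l, hl, hl'⟩ => ⟨l, ?_, hl'⟩⟩
      by_contra hc
      exact absurd (hl'.succ_lt (not_le.1 hc)) (not_lt.2 hl)
  · intro f hf
    obtain ⟨i, p, hp', e⟩ := hlim_lab f hf
    refine Prf.conj_intro (hXl _) _ fun g => weaken_of _ _ _ ?_
    rcases hlab g.1 f g.2.1 with e' | ⟨i', p', q, e', e''⟩
    · exact .inl ⟨e', .inr ⟨i, p, hp', e⟩⟩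
    · obtain ⟨rfl, rfl⟩ : i = i' ∧ p = q := by simpa [e] using e''
      exact .inr ⟨_, _, _, e', e, hp'⟩
  · intro f hf
    obtain ⟨i, p, hp', e⟩ := hlim_lab f hf
    have hlt₁ : a < f.level := lim_lt _ hf
    have hlt : Order.succ a < f.level := hf.succ_lt hlt₁
    obtain ⟨i', q, hq, e₂⟩ := hlab_two (f.restrict hlt.le) rfl
    obtain rfl : i = i' := by
      obtain e' | ⟨i'', p', q', e', e''⟩ := hlab _ f (f.restrict_le hlt.le)
      · simp [e₂] at e'
      · simp only [e, e₂, Option.some.injEq, Prod.mk.injEq] at e' e''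
        exact e''.1.trans e'.1.symm
    refine (join (lab (f.restrict hlt₁.le)) (lab (f.restrict hlt.le)) (lab f) i p q
      (hmono _ _ (f.restrict_le _)) (hmono _ _ (f.restrict_le _)) _ (frobLabel_of_le le_rfl)
      hq e₂ e ?_ ?_).1 hp'
    · exact Prf.conj_elim (hXl _) _
        (fun h : f.Pred => (φl (lab h.1)).weaken (hmono h.1 f h.2.1))
        ⟨f.restrict hlt₁.le, f.restrict_le _, hlt₁⟩
    · exact Prf.conj_elim (hXl _) _
        (fun h : f.Pred => (φl (lab h.1)).weaken (hmono h.1 f h.2.1))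
        ⟨f.restrict hlt.le, f.restrict_le _, hlt⟩
  · intro b
    refine ⟨Order.succ a, ?_⟩
    set f : Node κ ι := Node.ofBranch b (Order.succ a) with hf
    have hle : a ≤ f.level := Order.le_succ a
    obtain ⟨i, q, hq, e₂⟩ := hlab_two f rfl
    rw [Fml.weaken_weaken]
    refine (join (lab (f.restrict hle)) (lab f) (lab f) i q q
      (hmono _ _ (f.restrict_le _)) (fun _ => subset_rfl) _ (frobLabel_of_le le_rfl)
      hq e₂ e₂ ?_ ?_).2
    · exact Prf.pathConj_elim (fun f => Xl (lab f)) hmono (fun f => φl (lab f)) hκ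
        (fun f => hXl _) (f.restrict_le hle) ⟨z, Order.covBy_succ z⟩
    · exact Prf.pathConj_elim (fun f => Xl (lab f)) hmono (fun f => φl (lab f)) hκ
        (fun f => hXl _) Node.le_rfl ⟨a, Order.covBy_succ a⟩

end Frobenius

/-! ### Equality -/

namespace Prf

variable {Γ : Ctx L.Sorts} {φ : Fml L Γ}

/-- Replacement of terms by provably equal ones; the rule has it for variables only. -/
theorem eq_congr (hκ : ℵ₀ ≤ κ) (hΓ : IsSmallCtx κ Γ) {W : Ctx L.Sorts} (hW : IsSmallCtx κ W)
    (t t' : ∀ s, W s → Term L Γ s) (χ : Fml L (Γ.append W))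
    (h : ∀ s w, Prf T φ (.eq (t s w) (t' s w)))
    (hχ : Prf T φ (χ.subst fun s => Sum.elim (fun x => .var x) (t s))) :
    Prf T φ (χ.subst fun s => Sum.elim (fun x => .var x) (t' s)) := by
  have h1 := (eq_subst (T := T) hκ ((hΓ.append hκ hW).append hκ hW) hW
    (fun _ w => .inl (.inr w)) (fun _ w => .inr w) (χ.rename fun s =>
      Sum.elim (fun x => .inl (.inl (.inl x))) fun w => .inr w)).subst hΓ
    fun s => Sum.elim (Sum.elim (fun x => .var x) (t s)) (t' s)
  rw [Fml.subst_and, Fml.subst_rename, Fml.subst_rename, Fml.subst_rename, Fml.subst_rename] at h1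
  have h2 : Prf T (.and hκ (.conj (Σ s, W s) hW fun w => .eq (t w.1 w.2) (t' w.1 w.2))
      (χ.subst fun s => Sum.elim (fun x => .var x) (t s)))
      (χ.subst fun s => Sum.elim (fun x => .var x) (t' s)) := by
    convert h1 using 2
    · rfl
    · congr 1
      funext s x
      rcases x with x | x <;> rfl
    · funext s x
      rcases x with x | x <;> rfl
  exact cut (and_intro hκ hΓ (conj_intro hΓ _ fun w : Σ s, W s => h w.1 w.2) hχ) h2

theorem eq_rfl (hκ : ℵ₀ ≤ κ) (hΓ : IsSmallCtx κ Γ) {s : L.Sorts} (t : Term L Γ s) :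
    Prf T φ (.eq t t) := by
  have h := (eq_refl (T := T) hκ (isSmallCtx_single hκ s) ⟨⟨⟩, rfl⟩).subst hΓ
    fun s' (x : Ctx.single s s') => x.2 ▸ t
  rw [Fml.subst_top] at h
  exact (top_intro hκ hΓ φ).cut h

theorem eq_congr_single (hκ : ℵ₀ ≤ κ) (hΓ : IsSmallCtx κ Γ) {s : L.Sorts} {t t' : Term L Γ s}
    (χ : Fml L (Γ.append (Ctx.single s))) (h : Prf T φ (.eq t t'))
    (hχ : Prf T φ (χ.subst fun _ => Sum.elim (fun x => .var x) fun w => w.2 ▸ t)) :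
    Prf T φ (χ.subst fun _ => Sum.elim (fun x => .var x) fun w => w.2 ▸ t') := by
  refine eq_congr hκ hΓ (isSmallCtx_single hκ s) (fun _ w => w.2 ▸ t) _ χ ?_ hχ
  rintro _ ⟨_, rfl⟩
  exact h

theorem eq_symm (hκ : ℵ₀ ≤ κ) (hΓ : IsSmallCtx κ Γ) {s : L.Sorts} {t t' : Term L Γ s}
    (h : Prf T φ (.eq t t')) : Prf T φ (.eq t' t) := by
  have := eq_congr_single hκ hΓ
    (.eq (.var (.inr ⟨⟨⟩, rfl⟩)) (t.subst fun _ x => .var (.inl x))) h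
  simp only [Fml.subst, Term.subst_subst, Term.subst, Sum.elim_inl, Sum.elim_inr,
    Term.subst_var] at this
  exact this (eq_rfl hκ hΓ t)

theorem eq_trans (hκ : ℵ₀ ≤ κ) (hΓ : IsSmallCtx κ Γ) {s : L.Sorts} {t t' t'' : Term L Γ s}
    (h : Prf T φ (.eq t t')) (h' : Prf T φ (.eq t' t'')) : Prf T φ (.eq t t'') := by
  have := eq_congr_single hκ hΓ
    (.eq (t.subst fun _ x => .var (.inl x)) (.var (.inr ⟨⟨⟩, rfl⟩))) h'
  simp only [Fml.subst, Term.subst_subst, Term.subst, Sum.elim_inl, Sum.elim_inr,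
    Term.subst_var] at this
  exact this h

theorem eq_app (hκ : ℵ₀ ≤ κ) (hΓ : IsSmallCtx κ Γ) (f : L.Func) {t t' : ∀ s, L.dom f s → Term L Γ s}
    (h : ∀ s i, Prf T φ (.eq (t s i) (t' s i))) : Prf T φ (.eq (.app f t) (.app f t')) := by
  have := eq_congr hκ hΓ (L.dom_small f) t t'
    (.eq (.app f fun s i => (t s i).subst fun _ x => .var (.inl x))
      (.app f fun _ i => .var (.inr i))) h
  simp only [Fml.subst, Term.subst_subst, Term.subst, Sum.elim_inl, Sum.elim_inr,
    Term.subst_var] at this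
  exact this (eq_rfl hκ hΓ _)

theorem rel_congr (hκ : ℵ₀ ≤ κ) (hΓ : IsSmallCtx κ Γ) (R : L.Rel)
    {t t' : ∀ s, L.arity R s → Term L Γ s} (h : ∀ s i, Prf T φ (.eq (t s i) (t' s i)))
    (hR : Prf T φ (.rel R t)) : Prf T φ (.rel R t') := by
  have := eq_congr hκ hΓ (L.arity_small R) t t' (.rel R fun _ i => .var (.inr i)) h
  simp only [Fml.subst, Term.subst, Sum.elim_inr] at this
  exact this hR

end Prf

/-! ### Stages -/

/-- The pool from which the variables of the tree of stages are taken: `κ` variables of each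
sort. -/
abbrev Pool (L : Signature κ) : Ctx L.Sorts := fun _ => κ.ord.ToType

/-- A stage of the construction of a model: a small set of variables that name elements, and a
formula in these variables. -/
structure Stage (L : Signature κ) where
  X : ∀ s, Set (Pool L s)
  small : IsSmallCtx κ (toCtx X)
  φ : Fml L (toCtx X)

/-- Falsity, the empty disjunction. -/
def Fml.bot {Γ : Ctx L.Sorts} : Fml L Γ :=
  .disj PEmpty (by rw [mk_eq_zero]; exact zero_le) PEmpty.elim

namespace Stage

variable (T) in
/-- The formula `χ` in the context `Δ`, with its variables named by `ρ`, is known at the stage. -/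
def Forces (S : Stage L) {Δ : Ctx L.Sorts} (χ : Fml L Δ) (ρ : ∀ s, Δ s → Pool L s) : Prop :=
  ∃ h : ∀ s x, ρ s x ∈ S.X s, Prf T S.φ (χ.rename fun s x => ⟨ρ s x, h s x⟩)

variable (T) in
/-- `S'` extends `S`: it has at least the variables of `S`, and what it asserts implies what `S`
asserts. -/
def Ext (S S' : Stage L) : Prop :=
  ∃ h : ∀ s, S.X s ⊆ S'.X s, Prf T S'.φ (S.φ.weaken h)

variable (T) in
/-- Everything is known at the stage. -/
def Inconsistent (S : Stage L) : Prop := ∀ ψ : Fml L (toCtx S.X), Prf T S.φ ψ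

theorem Ext.refl (S : Stage L) : Ext T S S :=
  ⟨fun _ => subset_rfl, by rw [Fml.weaken_refl]; exact Prf.id S.small _⟩

theorem Ext.trans {S S' S'' : Stage L} (h : Ext T S S') (h' : Ext T S' S'') : Ext T S S'' := by
  obtain ⟨h, hp⟩ := h
  obtain ⟨h', hp'⟩ := h'
  refine ⟨fun s => (h s).trans (h' s), hp'.cut ?_⟩
  rw [← Fml.weaken_weaken h h']
  exact hp.weaken S''.small h'

theorem Forces.mono {S S' : Stage L} (h : Ext T S S') {Δ : Ctx L.Sorts} {χ : Fml L Δ}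
    {ρ : ∀ s, Δ s → Pool L s} (hf : S.Forces T χ ρ) : S'.Forces T χ ρ := by
  obtain ⟨h, hp⟩ := h
  obtain ⟨hρ, hf⟩ := hf
  refine ⟨fun s x => h s (hρ s x), hp.cut ?_⟩
  have := hf.weaken S'.small h
  rwa [Fml.weaken_rename] at this

theorem exNew_self (S : Stage L) : Prf T S.φ (S.φ.exNew S.X S.small) := by
  have := Prf.exNew_intro (T := T) S.small S.small (fun _ => subset_rfl) S.φ
  rwa [Fml.weaken_refl] at this

variable (T) in
/-- At the stage, a disjunction has a true disjunct, or an existential formula has a witness. -/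
def Resolves (S : Stage L) : ∀ {Δ : Ctx L.Sorts}, Fml L Δ → (∀ s, Δ s → Pool L s) → Prop
  | _, .disj _ _ χ, ρ => ∃ i, S.Forces T (χ i) ρ
  | _, .ex Y _ χ, ρ =>
    ∃ w : ∀ s, Y s → Pool L s, S.Forces T χ fun s => Sum.elim (ρ s) (w s)
  | _, _, _ => True

theorem Resolves.mono {S S' : Stage L} (h : Ext T S S') {Δ : Ctx L.Sorts} {χ : Fml L Δ}
    {ρ : ∀ s, Δ s → Pool L s} (hr : S.Resolves T χ ρ) : S'.Resolves T χ ρ := by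
  cases χ with
  | eq | rel | conj => trivial
  | disj ι hι χ => exact hr.imp fun _ => Forces.mono h
  | ex Y hY χ => exact hr.imp fun _ => Forces.mono h

/-- Fresh variables for a small block. -/
theorem exists_fresh (hκ : ℵ₀ ≤ κ) (S : Stage L) {Y : Ctx L.Sorts} (hY : IsSmallCtx κ Y) :
    ∃ w : ∀ s, Y s → Pool L s, (∀ s, Function.Injective (w s)) ∧ ∀ s y, w s y ∉ S.X s := by
  have : Infinite κ.ord.ToType := by rwa [infinite_iff, mk_ord_toType]
  have h : ∀ s, Nonempty (Y s ↪ ((S.X s)ᶜ : Set (Pool L s))) := fun s => by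
    rw [← le_def, mk_compl_of_infinite _ ((S.small.mk_lt s).trans_eq (mk_ord_toType κ).symm),
      mk_ord_toType]
    exact (hY.mk_lt s).le
  exact ⟨fun s y => (h s).some y, fun s => Subtype.val_injective.comp (h s).some.injective,
    fun s y => ((h s).some y).2⟩

/-- Every formula can be processed at every stage, by at most `κ` extensions one of which must be
the case. -/
theorem exists_step (hκ : ℵ₀ ≤ κ) (hpow : κ ^< κ = κ) (S : Stage L) {Δ : Ctx L.Sorts}
    (χ : Fml L Δ) (ρ : ∀ s, Δ s → Pool L s) :
    ∃ F : κ.ord.ToType → Stage L, (∀ i, Ext T S (F i)) ∧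
      Prf T S.φ (.disj κ.ord.ToType (mk_ord_toType κ).le fun i =>
        (F i).φ.exNew S.X (F i).small) ∧
      (S.Forces T χ ρ → ∀ i, (F i).Resolves T χ ρ ∨ (F i).Inconsistent T) := by
  obtain ⟨i₀⟩ := nonempty_toType_ord hκ
  -- when there is nothing to do, all extensions are `S` itself
  have triv : (S.Forces T χ ρ → S.Resolves T χ ρ) → _ := fun hres =>
    (⟨fun _ => S, fun _ => Ext.refl S, S.exNew_self.cut (Prf.disj_intro S.small _
      (fun _ : κ.ord.ToType => S.φ.exNew S.X S.small) i₀), fun h _ => .inl (hres h)⟩ :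
      ∃ F : κ.ord.ToType → Stage L, (∀ i, Ext T S (F i)) ∧
      Prf T S.φ (.disj κ.ord.ToType (mk_ord_toType κ).le fun i =>
        (F i).φ.exNew S.X (F i).small) ∧
      (S.Forces T χ ρ → ∀ i, (F i).Resolves T χ ρ ∨ (F i).Inconsistent T))
  by_cases hF : S.Forces T χ ρ
  swap
  · exact triv fun h => absurd h hF
  cases χ with
  | eq t t' => exact triv fun _ => trivial
  | rel R t => exact triv fun _ => trivial
  | conj ι hι χ => exact triv fun _ => trivial
  | disj ι hι χ =>
    clear triv
    obtain ⟨hρ, hp⟩ := hF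
    -- the extensions are indexed by `κ`; an index that stands for no disjunct gets falsity
    obtain ⟨r, hr⟩ : ∃ r : κ.ord.ToType → Option ι, ∀ j, ∃ i, r i = some j := by
      obtain ⟨e⟩ : Nonempty (ι ↪ κ.ord.ToType) := by rwa [← le_def, mk_ord_toType]
      exact ⟨Function.partialInv e, fun j => ⟨e j, Function.partialInv_left e.injective j⟩⟩
    let θ : Option ι → Fml L (toCtx S.X) := fun o =>
      o.elim .bot fun j => (χ j).rename fun s x => ⟨ρ s x, hρ s x⟩
    let F : κ.ord.ToType → Stage L := fun i => ⟨S.X, S.small, .and hκ S.φ (θ (r i))⟩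
    refine ⟨F, fun i => ⟨fun _ => subset_rfl, ?_⟩, ?_, fun _ i => ?_⟩
    · rw [Fml.weaken_refl]
      exact Prf.and_left hκ S.small _ _
    · refine Prf.of_disj_exNew S.X (fun _ => S.X) hκ hpow hι S.small (fun _ => S.small)
        (fun _ _ => subset_rfl) _ _ (fun j => θ (some j)) (hp.cut ?_) fun j => ?_
      · exact Prf.disj_mono S.small _ _ fun j =>
          ⟨j, (⟨S.X, S.small, θ (some j)⟩ : Stage L).exNew_self⟩
      · rw [Fml.weaken_refl, Fml.weaken_refl]
        obtain ⟨i, hi⟩ := hr j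
        have := (F i).exNew_self.cut (Prf.disj_intro (T := T) S.small (mk_ord_toType κ).le
          (fun i => (F i).φ.exNew S.X (F i).small) i)
        simp only [F, hi] at this
        exact this
    · have hr := Prf.and_right (T := T) hκ S.small S.φ (θ (r i))
      rcases h : r i with _ | j
      · rw [h] at hr
        refine .inr fun ψ => ?_
        simp only [F, h]
        exact hr.cut (Prf.disj_elim S.small _ fun e => e.elim)
      · rw [h] at hr
        refine .inl ⟨j, hρ, ?_⟩
        simp only [F, h]
        exact hr
  | ex Y hY χ =>
    clear triv
    obtain ⟨hρ, hp⟩ := hF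
    obtain ⟨w, hw, hfresh⟩ := S.exists_fresh hκ hY
    let X' : ∀ s, Set (Pool L s) := fun s => S.X s ∪ Set.range (w s)
    have hX' : IsSmallCtx κ (toCtx X') := S.small.union hκ (hY.range w)
    have hsub : ∀ s, S.X s ⊆ X' s := fun s => Set.subset_union_left
    let j : ∀ s, (toCtx S.X).append Y s → toCtx X' s := fun s =>
      Sum.elim (Set.inclusion (hsub s)) fun y => ⟨w s y, .inr ⟨y, rfl⟩⟩
    have hj : ∀ s, Function.Bijective (j s) := by
      refine fun s => ⟨?_, ?_⟩
      · rintro (x | x) (y | y) hxy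
        · exact congrArg _ (Set.inclusion_injective (hsub s) hxy)
        · have : x.1 = w s y := congrArg Subtype.val hxy
          exact absurd (this ▸ x.2) (hfresh s y)
        · have : w s x = y.1 := congrArg Subtype.val hxy
          exact absurd (this ▸ y.2) (hfresh s x)
        · exact congrArg _ (hw s (congrArg Subtype.val hxy))
      · rintro ⟨x, hx | ⟨y, rfl⟩⟩
        · exact ⟨.inl ⟨x, hx⟩, rfl⟩
        · exact ⟨.inr y, rfl⟩
    rw [Fml.rename_ex] at hp
    have hp' := hp.cut (Prf.exNew_of_ex hκ S.small hX' hsub hY j hj (fun _ _ => rfl) _)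
    set θ := Fml.rename (Fml.rename χ _) j with hθ
    let S' : Stage L := ⟨X', hX', .and hκ (S.φ.weaken hsub) θ⟩
    refine ⟨fun _ => S', fun _ => ⟨hsub, Prf.and_left hκ hX' _ _⟩, ?_, fun _ _ => .inl ?_⟩
    · refine Prf.of_disj_exNew (ι := κ.ord.ToType) S.X (fun _ => X') hκ hpow
        (mk_ord_toType κ).le S.small (fun _ => hX') (fun _ => hsub) _ _ (fun _ => θ) ?_ fun _ => ?_
      · exact hp'.cut (Prf.disj_intro S.small (mk_ord_toType κ).le
          (fun _ : κ.ord.ToType => θ.exNew S.X hX') i₀)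
      · refine (Prf.exNew_intro (T := T) S.small hX' hsub S'.φ).cut (Prf.weaken hX' hsub ?_)
        exact Prf.disj_intro S.small (mk_ord_toType κ).le
          (fun _ : κ.ord.ToType => S'.φ.exNew S.X hX') i₀
    · refine ⟨w, ?_, ?_⟩
      · rintro s (x | y)
        · exact .inl (hρ s x)
        · exact .inr ⟨y, rfl⟩
      · convert Prf.and_right (T := T) hκ hX' (S.φ.weaken hsub) θ using 1
        rw [hθ, Fml.rename_rename]
        congr 1
        funext s x
        rcases x with x | y <;> rfl

end Stage

/-! ### The tree of stages -/

namespace Stage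

/-- The least common extension of `S₀` and of a small family of extensions of it. -/
def join (hreg : κ.IsRegular) (S₀ : Stage L) {ι : Type u} (hι : #ι < κ) (F : ι → Stage L) :
    Stage L where
  X s := S₀.X s ∪ ⋃ i, (F i).X s
  small := S₀.small.union hreg.aleph0_le (IsSmallCtx.iUnion hreg hι fun i => (F i).small)
  φ := .and hreg.aleph0_le (S₀.φ.weaken fun _ => Set.subset_union_left)
    (.conj ι hι fun i => (F i).φ.weaken fun s =>
      (Set.subset_iUnion (fun i => (F i).X s) i).trans Set.subset_union_right)

variable (hreg : κ.IsRegular) (S₀ : Stage L)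

theorem ext_join_left {ι : Type u} (hι : #ι < κ) (F : ι → Stage L) :
    Ext T S₀ (join hreg S₀ hι F) :=
  ⟨_, Prf.and_left hreg.aleph0_le (join hreg S₀ hι F).small _ _⟩

theorem ext_join_right {ι : Type u} (hι : #ι < κ) (F : ι → Stage L) (i : ι) :
    Ext T (F i) (join hreg S₀ hι F) :=
  ⟨fun s => (Set.subset_iUnion (fun i => (F i).X s) i).trans Set.subset_union_right,
    (Prf.and_right hreg.aleph0_le (join hreg S₀ hι F).small _ _).cut
    (Prf.conj_elim (join hreg S₀ hι F).small hι (fun i => (F i).φ.weaken fun s =>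
      (Set.subset_iUnion (fun i => (F i).X s) i).trans Set.subset_union_right) i)⟩

theorem join_ext {ι : Type u} (hι : #ι < κ) {F : ι → Stage L} {S : Stage L}
    (h₀ : Ext T S₀ S) (h : ∀ i, Ext T (F i) S) : Ext T (join hreg S₀ hι F) S := by
  refine ⟨fun s => Set.union_subset (h₀.1 s) (Set.iUnion_subset fun i => (h i).1 s), ?_⟩
  simp only [join, Fml.weaken, Fml.rename_and, Fml.rename_conj]
  refine Prf.and_intro hreg.aleph0_le S.small ?_ (Prf.conj_intro S.small _ fun i => ?_)
  · rw [Fml.rename_rename]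
    exact h₀.2
  · rw [Fml.rename_rename]
    exact (h i).2

variable (step : κ.ord.ToType → Stage L → κ.ord.ToType → Stage L)

theorem mk_Iio_lt_ord (a : κ.ord.ToType) : #(Set.Iio a) < κ := by
  simpa using mk_Iio_lt a (by simp)

/-- The stage reached at time `a` on the branch `b`, when `step` gives the possible next stages:
it collects everything added at earlier times. -/
def run (b : κ.ord.ToType → κ.ord.ToType) (a : κ.ord.ToType) : Stage L :=
  join hreg S₀ (ι := Set.Iio a) (mk_Iio_lt_ord a) fun c => step c (run b c.1) (b c)
termination_by a
decreasing_by exact c.2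

open Classical in
/-- A branch through a node. The entries beyond the node play no role. -/
noncomputable def branchThrough [Inhabited κ.ord.ToType] (f : Node κ κ.ord.ToType) :
    κ.ord.ToType → κ.ord.ToType :=
  fun i => if h : i < f.level then f.val ⟨i, h⟩ else default

/-- The stage at a node. -/
noncomputable def atNode [Inhabited κ.ord.ToType] (f : Node κ κ.ord.ToType) : Stage L :=
  run hreg S₀ step (branchThrough f) f.level

theorem run_congr {b b' : κ.ord.ToType → κ.ord.ToType} (a : κ.ord.ToType)
    (h : ∀ c < a, b c = b' c) : run hreg S₀ step b a = run hreg S₀ step b' a := by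
  induction a using WellFoundedLT.induction with
  | ind a ih =>
    rw [run, run]
    congr 1
    funext c
    rw [ih c.1 c.2 fun d hd => h d (hd.trans c.2), h c.1 c.2]

theorem atNode_of_le [Inhabited κ.ord.ToType] {f g : Node κ κ.ord.ToType} (h : f ≤ g) :
    atNode hreg S₀ step f = run hreg S₀ step (branchThrough g) f.level := by
  refine run_congr hreg S₀ step _ fun c hc => ?_
  simp only [branchThrough, hc, hc.trans_le h.1, dif_pos]
  exact h.2 ⟨c, hc⟩

theorem atNode_ofBranch [Inhabited κ.ord.ToType] (b : κ.ord.ToType → κ.ord.ToType)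
    (a : κ.ord.ToType) :
    atNode hreg S₀ step (Node.ofBranch b a) = run hreg S₀ step b a := by
  refine run_congr hreg S₀ step _ fun c hc => ?_
  exact dif_pos hc

variable {S₀ step} (b : κ.ord.ToType → κ.ord.ToType)

theorem root_ext_run (a : κ.ord.ToType) : Ext T S₀ (run hreg S₀ step b a) := by
  rw [run]
  exact ext_join_left hreg S₀ _ _

theorem step_ext_run {a c : κ.ord.ToType} (h : c < a) :
    Ext T (step c (run hreg S₀ step b c) (b c)) (run hreg S₀ step b a) := by
  rw [run.eq_1 hreg S₀ step b a]
  exact ext_join_right hreg S₀ _ (fun c : Set.Iio a => step c (run hreg S₀ step b c) (b c))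
    ⟨c, h⟩

theorem run_ext {a : κ.ord.ToType} {S : Stage L} (h₀ : Ext T S₀ S)
    (h : ∀ c < a, Ext T (step c (run hreg S₀ step b c) (b c)) S) :
    Ext T (run hreg S₀ step b a) S := by
  rw [run]
  exact join_ext hreg S₀ _ h₀ fun c => h c.1 c.2

theorem run_mono (hext : ∀ a S i, Ext T S (step a S i)) {a c : κ.ord.ToType} (h : c ≤ a) :
    Ext T (run hreg S₀ step b c) (run hreg S₀ step b a) := by
  rcases h.eq_or_lt with rfl | h
  · exact Ext.refl _
  · exact (hext _ _ _).trans (step_ext_run hreg b h)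

theorem run_ext_step (hext : ∀ a S i, Ext T S (step a S i)) {a c : κ.ord.ToType} (h : a ⋖ c) :
    Ext T (run hreg S₀ step b c) (step a (run hreg S₀ step b a) (b a)) := by
  refine run_ext hreg b ((root_ext_run hreg b a).trans (hext _ _ _)) fun d hd => ?_
  rcases (h.le_of_lt hd).eq_or_lt with rfl | hd
  · exact Ext.refl _
  · exact (step_ext_run hreg b hd).trans (hext _ _ _)

/-- At a limit, nothing is added to the earlier stages. -/
theorem run_ext_of_isSuccLimit {a : κ.ord.ToType} (ha : Order.IsSuccLimit a) {S : Stage L}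
    (h : ∀ c < a, Ext T (run hreg S₀ step b c) S) : Ext T (run hreg S₀ step b a) S := by
  have := noMaxOrder hreg.aleph0_le
  obtain ⟨c, hc⟩ := not_isMin_iff.1 ha.not_isMin
  refine run_ext hreg b ((root_ext_run hreg b c).trans (h c hc)) fun d hd => ?_
  exact (step_ext_run hreg b (Order.lt_succ d)).trans (h _ (ha.succ_lt hd))

/-- What is eventually known along every branch is known at the root. -/
theorem forces_of_bar (hpow : κ ^< κ = κ) (hext : ∀ a S i, Ext T S (step a S i))
    (hcov : ∀ a S, Prf T S.φ (.disj κ.ord.ToType (mk_ord_toType κ).le fun i =>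
      (step a S i).φ.exNew S.X (step a S i).small))
    {Δ : Ctx L.Sorts} {χ : Fml L Δ} {ρ : ∀ s, Δ s → Pool L s} (hρ : ∀ s x, ρ s x ∈ S₀.X s)
    (hbar : ∀ b, ∃ a, (run hreg S₀ step b a).Forces T χ ρ) : S₀.Forces T χ ρ := by
  have hκ := hreg.aleph0_le
  have := noMaxOrder hκ
  have := nonempty_toType_ord hκ
  inhabit κ.ord.ToType
  obtain ⟨z, -, hz⟩ := (wellFounded_lt (α := κ.ord.ToType)).has_min _ Set.univ_nonempty
  replace hz : IsMin z := isMin_iff_forall_not_lt.2 fun a => hz a trivial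
  let S : Node κ κ.ord.ToType → Stage L := atNode hreg S₀ step
  let r : Node κ κ.ord.ToType := ⟨z, fun _ => default⟩
  have hmono : ∀ f g, f ≤ g → Ext T (S f) (S g) := fun f g h => by
    simp only [S]
    rw [atNode_of_le hreg S₀ step h]
    exact run_mono hreg _ hext h.1
  have hlim : ∀ f : Node κ κ.ord.ToType, Order.IsSuccLimit f.level → ∀ S' : Stage L,
      (∀ h : f.Pred, Ext T (S h.1) S') → Ext T (S f) S' := fun f hf S' h => by
    refine run_ext_of_isSuccLimit hreg _ hf fun c hc => ?_
    have := h ⟨f.restrict hc.le, f.restrict_le _, hc⟩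
    simp only [S] at this
    rwa [atNode_of_le hreg S₀ step (f.restrict_le hc.le)] at this
  have hroot : Ext T (S r) S₀ := run_ext hreg _ (Ext.refl _) fun c hc => absurd hc hz.not_lt
  have hroot' : Ext T S₀ (S r) := root_ext_run hreg _ _
  refine Forces.mono hroot ⟨fun s x => hroot'.1 s (hρ s x), ?_⟩
  refine Prf.of_bar (fun f => (S f).X) (fun f g h => (hmono f g h).1) (fun f => (S f).φ) hκ hpow
    (mk_ord_toType κ).le (fun f => (S f).small) ?_ r hz ?_ ?_ ?_ _ ?_
  · intro f hf s
    refine subset_antisymm ?_ (Set.iUnion_subset fun h => (hmono h.1 f h.2.1).1 s)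
    -- with falsity as its formula, the union of the contexts is an extension of all of them
    let S' : Stage L := ⟨fun s => ⋃ h : f.Pred, (S h.1).X s,
      IsSmallCtx.iUnion hreg f.mk_pred_lt fun h => (S h.1).small, .bot⟩
    exact (hlim f hf S' fun h => ⟨fun s => Set.subset_iUnion (fun h : f.Pred => (S h.1).X s) h,
      Prf.disj_elim S'.small _ fun e => e.elim⟩).1 s
  · intro f
    refine (hcov f.level (S f)).cut (Prf.disj_mono (S f).small _ _ fun i => ?_)
    have hc := f.isChild_snoc hκ i
    refine ⟨⟨_, hc⟩, ?_⟩
    obtain ⟨h, hp⟩ : Ext T (S (f.snoc i)) (step f.level (S f) i) := by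
      have := run_ext_step (S₀ := S₀) hreg (branchThrough (f.snoc i)) hext hc.2
      rw [← atNode_of_le hreg S₀ step hc.1] at this
      have e : branchThrough (f.snoc i) f.level = i := by
        rw [branchThrough, dif_pos hc.2.lt, f.snoc_val i rfl]
      rwa [e] at this
    exact Prf.exNew_mono hκ (S f).small _ _ (hmono _ _ hc.1).1 h hp
  · intro f _
    exact Prf.conj_intro (S f).small _ fun h => (hmono h.1 f h.2.1).2
  · intro f hf
    let S' : Stage L := ⟨(S f).X, (S f).small, .conj f.Pred f.mk_pred_lt fun h =>
      (S h.1).φ.weaken (hmono h.1 f h.2.1).1⟩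
    obtain ⟨h, hp⟩ := hlim f hf S' fun h => ⟨(hmono h.1 f h.2.1).1,
      Prf.conj_elim (S f).small f.mk_pred_lt
        (fun h : f.Pred => (S h.1).φ.weaken (hmono h.1 f h.2.1).1) h⟩
    rwa [Fml.weaken_refl] at hp
  · intro b
    obtain ⟨a, ha⟩ := hbar b
    -- only formulas on successor levels are accumulated along the path
    refine ⟨Order.succ a, ?_⟩
    have hf := ha.mono (run_mono hreg b hext (Order.le_succ a))
    rw [← atNode_ofBranch] at hf
    refine Prf.cut (Prf.pathConj_elim _ _ _ hκ (fun f => (S f).small) Node.le_rfl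
      ⟨a, Order.covBy_succ a⟩) ?_
    rw [Fml.weaken_refl, Fml.weaken_rename]
    exact hf.2

end Stage

/-! ### Sets with at most `κ` elements -/

theorem nonempty_toType_ord_equiv_prod (hκ : ℵ₀ ≤ κ) :
    Nonempty (κ.ord.ToType ≃ κ.ord.ToType × κ.ord.ToType) := by
  rw [← Cardinal.eq, mk_prod, mk_ord_toType, lift_id, mul_eq_self hκ]

/-- The set `A`, in an arbitrary universe, has at most `κ` elements: it is covered by a partial
enumeration in type `κ`. -/
def AtMost (κ : Cardinal.{u}) {α : Type v} (A : Set α) : Prop :=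
  ∃ g : κ.ord.ToType → Option α, ∀ a ∈ A, ∃ i, g i = some a

namespace AtMost

variable {α : Type v} {β : Type w}

theorem of_mk_le {A : Set α} (h : lift.{u} #A ≤ lift.{v} κ) : AtMost κ A := by
  obtain ⟨e⟩ : Nonempty (A ↪ κ.ord.ToType) := by
    rwa [← lift_mk_le', mk_ord_toType]
  refine ⟨fun i => (Function.partialInv e i).map Subtype.val, fun a ha => ⟨e ⟨a, ha⟩,
    congrArg (Option.map Subtype.val) (Function.partialInv_left e.injective ⟨a, ha⟩)⟩⟩

theorem mono {A B : Set α} (hB : AtMost κ B) (h : A ⊆ B) : AtMost κ A :=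
  hB.imp fun _ hg a ha => hg a (h ha)

theorem image {A : Set α} (hA : AtMost κ A) (f : α → β) : AtMost κ (f '' A) := by
  obtain ⟨g, hg⟩ := hA
  refine ⟨fun i => (g i).map f, ?_⟩
  rintro _ ⟨a, ha, rfl⟩
  obtain ⟨i, hi⟩ := hg a ha
  exact ⟨i, congrArg (Option.map f) hi⟩

theorem univ_of_mk_le {ι : Type u} (h : #ι ≤ κ) : AtMost κ (Set.univ : Set ι) :=
  of_mk_le (by rw [mk_univ]; exact lift_le.2 h)

theorem range_of_mk_le {ι : Type u} (h : #ι ≤ κ) (f : ι → β) : AtMost κ (Set.range f) := by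
  rw [← Set.image_univ]
  exact (univ_of_mk_le h).image f

theorem biUnion (hκ : ℵ₀ ≤ κ) {A : Set α} (hA : AtMost κ A) {F : α → Set β}
    (hF : ∀ a ∈ A, AtMost κ (F a)) : AtMost κ (⋃ a ∈ A, F a) := by
  obtain ⟨g, hg⟩ := hA
  obtain ⟨e⟩ := nonempty_toType_ord_equiv_prod hκ
  have : ∀ a, ∃ g' : κ.ord.ToType → Option β, a ∈ A → ∀ b ∈ F a, ∃ i, g' i = some b := fun a => by
    by_cases ha : a ∈ A
    · exact (hF a ha).imp fun _ h _ => h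
    · exact ⟨fun _ => none, fun h => absurd h ha⟩
  choose g' hg' using this
  refine ⟨fun i => (g (e i).1).bind fun a => g' a (e i).2, fun b hb => ?_⟩
  obtain ⟨a, ha, hb⟩ := Set.mem_iUnion₂.1 hb
  obtain ⟨i, hi⟩ := hg a ha
  obtain ⟨j, hj⟩ := hg' a ha b hb
  exact ⟨e.symm (i, j), by simp [hi, hj]⟩

theorem iUnion (hκ : ℵ₀ ≤ κ) {ι : Type u} (hι : #ι ≤ κ) {F : ι → Set β}
    (hF : ∀ i, AtMost κ (F i)) : AtMost κ (⋃ i, F i) := by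
  have := (univ_of_mk_le hι).biUnion hκ (F := F) fun i _ => hF i
  rwa [Set.biUnion_univ] at this

theorem union (hκ : ℵ₀ ≤ κ) {A B : Set α} (hA : AtMost κ A) (hB : AtMost κ B) :
    AtMost κ (A ∪ B) := by
  refine (iUnion (ι := ULift Bool) hκ ((lt_aleph0_of_finite _).le.trans hκ)
    (F := fun b => cond b.down A B) ?_).mono ?_
  · rintro ⟨_ | _⟩ <;> assumption
  · rintro a (ha | ha)
    exacts [Set.mem_iUnion.2 ⟨⟨true⟩, ha⟩, Set.mem_iUnion.2 ⟨⟨false⟩, ha⟩]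

theorem singleton (hκ : ℵ₀ ≤ κ) (a : α) : AtMost κ {a} := by
  have := range_of_mk_le (κ := κ) (ι := PUnit) ((lt_aleph0_of_finite _).le.trans hκ) fun _ => a
  rwa [Set.range_const] at this

/-- A set of at most `κ` elements can be enumerated in type `κ` with every element recurring
cofinally often. -/
theorem exists_cofinal (hκ : ℵ₀ ≤ κ) {A : Set α} (hA : AtMost κ A) :
    ∃ e : κ.ord.ToType → Option α, ∀ a ∈ A, ∀ c, ∃ i, c ≤ i ∧ e i = some a := by
  obtain ⟨g, hg⟩ := hA
  obtain ⟨e⟩ := nonempty_toType_ord_equiv_prod hκ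
  refine ⟨fun i => g (e i).1, fun a ha c => ?_⟩
  obtain ⟨i, hi⟩ := hg a ha
  by_contra! hc
  have hlt : ∀ j, e.symm (i, j) < c := fun j => by
    by_contra! h
    exact hc _ h (by simp [hi])
  have := mk_le_of_injective (f := fun j => (⟨e.symm (i, j), hlt j⟩ : Set.Iio c))
    fun j j' h => (Prod.mk.inj (e.symm.injective (congrArg Subtype.val h))).2
  rw [mk_ord_toType] at this
  exact absurd (Stage.mk_Iio_lt_ord c) (not_lt.2 this)

end AtMost

/-! ### Requirements -/

/-- The function symbols that occur in a term. -/
def Term.funcs {Γ : Ctx L.Sorts} : ∀ {s : L.Sorts}, Term L Γ s → Set L.Func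
  | _, .var _ => ∅
  | _, .app f t => {f} ∪ ⋃ p : Σ s, L.dom f s, (t p.1 p.2).funcs

theorem Term.atMost_funcs (hκ : ℵ₀ ≤ κ) {Γ : Ctx L.Sorts} {s : L.Sorts} (t : Term L Γ s) :
    AtMost κ t.funcs := by
  induction t with
  | var x => exact (AtMost.of_mk_le (by simp [Term.funcs]))
  | app f t ih =>
    exact (AtMost.singleton hκ f).union hκ (AtMost.iUnion hκ (L.dom_small f).le fun p => ih _ _)

variable (L) in
/-- A requirement: a disjunction or an existential formula that has to be resolved in the
construction of a model, whenever it becomes known. -/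
abbrev Req : Type (u + 1) := Σ Δ : Ctx L.Sorts, Fml L Δ

/-- The values of the function symbol `f` are named by variables: `∃ y, f x = y`. -/
def funcReq (hκ : ℵ₀ ≤ κ) (f : L.Func) : Req L :=
  ⟨L.dom f, .ex (Ctx.single (L.cod f)) (isSmallCtx_single hκ _)
    (.eq (.app f fun _ i => .var (.inl i)) (.var (.inr ⟨⟨⟩, rfl⟩)))⟩

/-- The sort `s` contains a variable if it is known to be inhabited: `∃ y, ⊤`. -/
def sortReq (hκ : ℵ₀ ≤ κ) (s : L.Sorts) : Req L :=
  ⟨fun _ => PEmpty, .ex (Ctx.single s) (isSmallCtx_single hκ _) (.top hκ)⟩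

/-- The requirements for the sorts of the variables of a context. -/
def sortReqs (hκ : ℵ₀ ≤ κ) (Γ : Ctx L.Sorts) : Set (Req L) :=
  Set.range fun p : Σ s, Γ s => sortReq hκ p.1

/-- The requirements that have to be met for the truth lemma to hold for a formula. -/
def Fml.reqs (hκ : ℵ₀ ≤ κ) : ∀ {Γ : Ctx L.Sorts}, Fml L Γ → Set (Req L)
  | _, .eq t t' => funcReq hκ '' (t.funcs ∪ t'.funcs)
  | _, .rel R t => funcReq hκ '' ⋃ p : Σ s, L.arity R s, (t p.1 p.2).funcs
  | _, .conj _ _ φ => ⋃ i, (φ i).reqs hκ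
  | Γ, .disj ι hι φ => {⟨Γ, .disj ι hι φ⟩} ∪ ⋃ i, (φ i).reqs hκ
  | Γ, .ex Y hY φ => {⟨Γ, .ex Y hY φ⟩} ∪ (sortReqs hκ Y ∪ φ.reqs hκ)

theorem atMost_sortReqs (hκ : ℵ₀ ≤ κ) {Γ : Ctx L.Sorts} (hΓ : IsSmallCtx κ Γ) :
    AtMost κ (sortReqs hκ Γ) :=
  AtMost.range_of_mk_le hΓ.le _

theorem Fml.atMost_reqs (hκ : ℵ₀ ≤ κ) {Γ : Ctx L.Sorts} (φ : Fml L Γ) :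
    AtMost κ (φ.reqs hκ) := by
  induction φ with
  | eq t t' => exact ((t.atMost_funcs hκ).union hκ (t'.atMost_funcs hκ)).image _
  | rel R t =>
    exact (AtMost.iUnion hκ (L.arity_small R).le fun p => (t p.1 p.2).atMost_funcs hκ).image _
  | conj ι hι φ ih => exact AtMost.iUnion hκ hι.le ih
  | disj ι hι φ ih => exact (AtMost.singleton hκ _).union hκ (AtMost.iUnion hκ hι ih)
  | ex Y hY φ ih =>
    exact (AtMost.singleton hκ _).union hκ ((atMost_sortReqs hκ hY).union hκ ih)

theorem isSmallCtx_sortReqs (hκ : ℵ₀ ≤ κ) (Γ : Ctx L.Sorts) :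
    ∀ p ∈ sortReqs hκ Γ, IsSmallCtx κ p.1 := by
  rintro _ ⟨q, rfl⟩
  exact isSmallCtx_empty hκ

theorem Fml.isSmallCtx_reqs (hκ : ℵ₀ ≤ κ) {Γ : Ctx L.Sorts} (hΓ : IsSmallCtx κ Γ) (φ : Fml L Γ) :
    ∀ p ∈ φ.reqs hκ, IsSmallCtx κ p.1 := by
  induction φ with
  | eq t t' =>
    rintro _ ⟨f, -, rfl⟩
    exact L.dom_small f
  | rel R t =>
    rintro _ ⟨f, -, rfl⟩
    exact L.dom_small f
  | conj ι hι φ ih =>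
    intro p hp
    obtain ⟨i, hi⟩ := Set.mem_iUnion.1 hp
    exact ih i hΓ p hi
  | disj ι hι φ ih =>
    rintro p (rfl | hp)
    · exact hΓ
    · obtain ⟨i, hi⟩ := Set.mem_iUnion.1 hp
      exact ih i hΓ p hi
  | ex Y hY φ ih =>
    rintro p (rfl | hp | hp)
    · exact hΓ
    · exact isSmallCtx_sortReqs hκ Y p hp
    · exact ih (hΓ.append hκ hY) p hp

/-- The requirements of a sequent. -/
def Sequent.reqs (hκ : ℵ₀ ≤ κ) (τ : Sequent L) : Set (Req L) :=
  sortReqs hκ τ.ctx ∪ (τ.lhs.reqs hκ ∪ τ.rhs.reqs hκ)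

theorem Sequent.atMost_reqs (hκ : ℵ₀ ≤ κ) (τ : Sequent L) : AtMost κ (τ.reqs hκ) :=
  (atMost_sortReqs hκ τ.small).union hκ ((τ.lhs.atMost_reqs hκ).union hκ (τ.rhs.atMost_reqs hκ))

theorem Sequent.isSmallCtx_reqs (hκ : ℵ₀ ≤ κ) (τ : Sequent L) :
    ∀ p ∈ τ.reqs hκ, IsSmallCtx κ p.1 := by
  rintro p (hp | hp | hp)
  exacts [isSmallCtx_sortReqs hκ _ p hp, τ.lhs.isSmallCtx_reqs hκ τ.small p hp,
    τ.rhs.isSmallCtx_reqs hκ τ.small p hp]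

/-- There are at most `κ` ways to name the variables of a small context by the pool. -/
theorem atMost_naming (hpow : κ ^< κ = κ) {Δ : Ctx L.Sorts} (hΔ : IsSmallCtx κ Δ) :
    AtMost κ (Set.univ : Set (∀ s, Δ s → Pool L s)) := by
  refine AtMost.of_mk_le ?_
  rw [mk_univ, mk_congr (Equiv.piCurry fun (s : L.Sorts) (_ : Δ s) => κ.ord.ToType).symm,
    lift_le, ← power_def, mk_ord_toType]
  conv_rhs => rw [← hpow]
  exact le_powerlt _ hΔ

/-! ### Branches -/

/-- An increasing sequence of stages along which all requirements in `F` are met. -/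
structure Branch (T : Set (Sequent L)) (F : Set (Req L)) where
  stage : κ.ord.ToType → Stage L
  mono : ∀ {a c}, a ≤ c → (stage a).Ext T (stage c)
  resolves : ∀ p ∈ F, ∀ ρ a, (stage a).Forces T p.2 ρ → ∃ c, (stage c).Resolves T p.2 ρ

/-- If what the stage `S₀` asserts does not imply `χ`, then there is a branch from `S₀` on which
`χ` is never known. -/
theorem exists_branch (hreg : κ.IsRegular) (hpow : κ ^< κ = κ) {F : Set (Req L)}
    (hF : AtMost κ F) (hsmall : ∀ p ∈ F, IsSmallCtx κ p.1) (S₀ : Stage L) {Δ : Ctx L.Sorts}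
    {χ : Fml L Δ} {ρ : ∀ s, Δ s → Pool L s} (hρ : ∀ s x, ρ s x ∈ S₀.X s)
    (hχ : ¬ S₀.Forces T χ ρ) :
    ∃ B : Branch T F, (∀ a, S₀.Ext T (B.stage a)) ∧ ∀ a, ¬ (B.stage a).Forces T χ ρ := by
  have hκ := hreg.aleph0_le
  have := noMaxOrder hκ
  obtain ⟨e, he⟩ := AtMost.exists_cofinal hκ (A := ⋃ p ∈ F, Set.range
    fun ρ : ∀ s, p.1 s → Pool L s => (⟨p, ρ⟩ : Σ p : Req L, ∀ s, p.1 s → Pool L s))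
    (hF.biUnion hκ fun p hp => by
      rw [← Set.image_univ]
      exact (atMost_naming hpow (hsmall p hp)).image _)
  have hstep : ∀ (a : κ.ord.ToType) (S : Stage L), ∃ F : κ.ord.ToType → Stage L,
      (∀ i, S.Ext T (F i)) ∧
      Prf T S.φ (.disj κ.ord.ToType (mk_ord_toType κ).le fun i =>
        (F i).φ.exNew S.X (F i).small) ∧
      ∀ q, e a = some q → S.Forces T q.1.2 q.2 →
        ∀ i, (F i).Resolves T q.1.2 q.2 ∨ (F i).Inconsistent T := by
    intro a S
    rcases h : e a with _ | q
    · obtain ⟨F, h1, h2, -⟩ := S.exists_step (T := T) hκ hpow χ ρ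
      exact ⟨F, h1, h2, fun q hq => by cases hq⟩
    · obtain ⟨F, h1, h2, h3⟩ := S.exists_step (T := T) hκ hpow q.1.2 q.2
      refine ⟨F, h1, h2, fun q' hq' => ?_⟩
      cases hq'
      exact h3
  choose step hext hcov hres using hstep
  have hb : ∃ b, ∀ a, ¬ (Stage.run hreg S₀ step b a).Forces T χ ρ := by
    by_contra! hbar
    exact hχ (Stage.forces_of_bar hreg hpow hext hcov hρ hbar)
  obtain ⟨b, hb⟩ := hb
  have hroot : ∀ a, S₀.Ext T (Stage.run hreg S₀ step b a) := Stage.root_ext_run hreg b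
  refine ⟨⟨Stage.run hreg S₀ step b, Stage.run_mono hreg b hext, fun p hp ρ' a ha => ?_⟩,
    hroot, hb⟩
  obtain ⟨i, hi, hei⟩ := he ⟨p, ρ'⟩ (Set.mem_biUnion hp ⟨ρ', rfl⟩) a
  have hnext := Stage.step_ext_run (T := T) (S₀ := S₀) (step := step) hreg b (Order.lt_succ i)
  rcases hres i _ _ hei (ha.mono (Stage.run_mono hreg b hext hi)) (b i) with h | h
  · exact ⟨Order.succ i, h.mono hnext⟩
  · refine absurd (Stage.Forces.mono hnext ⟨fun s x => ?_, h _⟩) (hb (Order.succ i))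
    exact (hext _ _ _).1 s ((hroot i).1 s (hρ s x))

/-! ### The model of a branch -/

/-- Fewer than `κ` elements of `κ` have a common bound. -/
theorem exists_bound (hreg : κ.IsRegular) {ι : Type u} (hι : #ι < κ) (a : ι → κ.ord.ToType) :
    ∃ c, ∀ i, a i ≤ c := by
  by_contra! h
  have hU : (⋃ i, Set.Iio (a i)) = Set.univ := Set.eq_univ_of_forall fun c =>
    let ⟨i, hi⟩ := h c
    Set.mem_iUnion.2 ⟨i, hi⟩
  have := mk_iUnion_le_sum_mk (f := fun i => Set.Iio (a i))
  rw [hU, mk_univ, mk_ord_toType] at this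
  exact absurd (sum_lt_of_isRegular hreg hι fun i => Stage.mk_Iio_lt_ord (a i)) (not_lt.2 this)

/-- The term consisting of the variable of `Ctx.single s`. -/
abbrev Term.point (s : L.Sorts) : Term L (Ctx.single s) s := .var ⟨⟨⟩, rfl⟩

namespace Stage

/-- The terms `t` and `t'`, with their variables named by `ρ` and `ρ'`, are known to be equal at
the stage. -/
def ForcesEq (T : Set (Sequent L)) (S : Stage L) {Δ Δ' : Ctx L.Sorts} {s : L.Sorts}
    (t : Term L Δ s) (ρ : ∀ s, Δ s → Pool L s) (t' : Term L Δ' s)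
    (ρ' : ∀ s, Δ' s → Pool L s) : Prop :=
  ∃ (h : ∀ s x, ρ s x ∈ S.X s) (h' : ∀ s x, ρ' s x ∈ S.X s),
    Prf T S.φ (.eq (t.subst fun s x => .var ⟨ρ s x, h s x⟩)
      (t'.subst fun s x => .var ⟨ρ' s x, h' s x⟩))

theorem ForcesEq.mono {S S' : Stage L} (h : Ext T S S') {Δ Δ' : Ctx L.Sorts} {s : L.Sorts}
    {t : Term L Δ s} {ρ : ∀ s, Δ s → Pool L s} {t' : Term L Δ' s} {ρ' : ∀ s, Δ' s → Pool L s}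
    (hf : S.ForcesEq T t ρ t' ρ') : S'.ForcesEq T t ρ t' ρ' := by
  obtain ⟨h, hp⟩ := h
  obtain ⟨h₁, h₂, hf⟩ := hf
  refine ⟨fun s x => h s (h₁ s x), fun s x => h s (h₂ s x), hp.cut ?_⟩
  have := hf.weaken S'.small h
  simpa only [Fml.weaken, Fml.rename, Fml.subst, Term.subst_subst, Term.subst] using this

end Stage

namespace Branch

variable {F : Set (Req L)} (B : Branch T F)

/-- The elements of sort `s` that are named along the branch. -/
abbrev Elem (s : L.Sorts) : Type u := {y : Pool L s // ∃ a, y ∈ (B.stage a).X s}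

variable {B}
variable {Δ Δ' Δ'' : Ctx L.Sorts}

/-- The names of a context, as variables of the pool. -/
abbrev names (ρ : ∀ s, Δ s → B.Elem s) : ∀ s, Δ s → Pool L s := fun s x => (ρ s x).1

variable (B) in
/-- The formula `χ` is eventually known along the branch. -/
def Holds (χ : Fml L Δ) (ρ : ∀ s, Δ s → B.Elem s) : Prop :=
  ∃ a, (B.stage a).Forces T χ (names ρ)

variable (B) in
/-- The terms `t` and `t'` are eventually known to be equal. -/
def HoldsEq {s : L.Sorts} (t : Term L Δ s) (ρ : ∀ s, Δ s → B.Elem s) (t' : Term L Δ' s)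
    (ρ' : ∀ s, Δ' s → B.Elem s) : Prop :=
  ∃ a, (B.stage a).ForcesEq T t (names ρ) t' (names ρ')

/-- The naming of the variable of `Ctx.single s`. -/
abbrev pt {s : L.Sorts} (y : B.Elem s) : ∀ s', Ctx.single s s' → B.Elem s' := fun _ x => x.2 ▸ y

theorem exists_stage (hreg : κ.IsRegular) (hΔ : IsSmallCtx κ Δ) (ρ : ∀ s, Δ s → B.Elem s) :
    ∃ a, ∀ s x, (ρ s x).1 ∈ (B.stage a).X s := by
  obtain ⟨c, hc⟩ := exists_bound hreg hΔ fun p : Σ s, Δ s => (ρ p.1 p.2).2.choose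
  exact ⟨c, fun s x => (B.mono (T := T) (hc ⟨s, x⟩)).1 s (ρ s x).2.choose_spec⟩

theorem HoldsEq.symm (hκ : ℵ₀ ≤ κ) {s : L.Sorts} {t : Term L Δ s} {ρ : ∀ s, Δ s → B.Elem s}
    {t' : Term L Δ' s} {ρ' : ∀ s, Δ' s → B.Elem s} (h : B.HoldsEq t ρ t' ρ') :
    B.HoldsEq t' ρ' t ρ := by
  obtain ⟨a, h₁, h₂, hp⟩ := h
  exact ⟨a, h₂, h₁, Prf.eq_symm hκ (B.stage a).small hp⟩

theorem HoldsEq.trans (hκ : ℵ₀ ≤ κ) {s : L.Sorts} {t : Term L Δ s} {ρ : ∀ s, Δ s → B.Elem s}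
    {t' : Term L Δ' s} {ρ' : ∀ s, Δ' s → B.Elem s} {t'' : Term L Δ'' s}
    {ρ'' : ∀ s, Δ'' s → B.Elem s} (h : B.HoldsEq t ρ t' ρ') (h' : B.HoldsEq t' ρ' t'' ρ'') :
    B.HoldsEq t ρ t'' ρ'' := by
  obtain ⟨a, ha⟩ := h
  obtain ⟨a', ha'⟩ := h'
  obtain ⟨h₁, _, hp⟩ := ha.mono (B.mono (le_max_left a a'))
  obtain ⟨_, h₂, hp'⟩ := ha'.mono (B.mono (le_max_right a a'))
  exact ⟨max a a', h₁, h₂, Prf.eq_trans hκ (B.stage _).small hp hp'⟩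

theorem HoldsEq.refl (hreg : κ.IsRegular) (hΔ : IsSmallCtx κ Δ) {s : L.Sorts} (t : Term L Δ s)
    (ρ : ∀ s, Δ s → B.Elem s) : B.HoldsEq t ρ t ρ := by
  obtain ⟨a, ha⟩ := exists_stage hreg hΔ ρ
  exact ⟨a, ha, ha, Prf.eq_rfl hreg.aleph0_le (B.stage a).small _⟩

theorem holdsEq_var (hreg : κ.IsRegular) (hΔ : IsSmallCtx κ Δ) {s : L.Sorts} (x : Δ s)
    (ρ : ∀ s, Δ s → B.Elem s) : B.HoldsEq (.var x) ρ (Term.point s) (pt (ρ s x)) := by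
  obtain ⟨a, ha⟩ := exists_stage hreg hΔ ρ
  refine ⟨a, ha, ?_, Prf.eq_rfl hreg.aleph0_le (B.stage a).small _⟩
  rintro _ ⟨_, rfl⟩
  exact ha _ x

/-- Fewer than `κ` known equations are known at a common stage, as late as desired. -/
theorem exists_stage_eq (hreg : κ.IsRegular) (hΔ : IsSmallCtx κ Δ) (hΔ' : IsSmallCtx κ Δ')
    (hΔ'' : IsSmallCtx κ Δ'') {ρ : ∀ s, Δ s → B.Elem s} {ρ' : ∀ s, Δ' s → B.Elem s}
    {t : ∀ s, Δ'' s → Term L Δ s} {t' : ∀ s, Δ'' s → Term L Δ' s}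
    (h : ∀ s i, B.HoldsEq (t s i) ρ (t' s i) ρ') (c : κ.ord.ToType) :
    ∃ a, c ≤ a ∧ ∃ (h₁ : ∀ s x, (ρ s x).1 ∈ (B.stage a).X s)
      (h₂ : ∀ s x, (ρ' s x).1 ∈ (B.stage a).X s), ∀ s i, Prf T (B.stage a).φ
        (.eq ((t s i).subst fun s x => .var ⟨(ρ s x).1, h₁ s x⟩)
          ((t' s i).subst fun s x => .var ⟨(ρ' s x).1, h₂ s x⟩)) := by
  obtain ⟨a₁, h₁⟩ := exists_stage hreg hΔ ρ
  obtain ⟨a₂, h₂⟩ := exists_stage hreg hΔ' ρ'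
  choose a ha using h
  obtain ⟨d, hd⟩ := exists_bound hreg hΔ'' fun p : Σ s, Δ'' s => a p.1 p.2
  have e₁ : a₁ ≤ max (max a₁ a₂) (max c d) := (le_max_left _ _).trans (le_max_left _ _)
  have e₂ : a₂ ≤ max (max a₁ a₂) (max c d) := (le_max_right _ _).trans (le_max_left _ _)
  have e₃ : d ≤ max (max a₁ a₂) (max c d) := (le_max_right _ _).trans (le_max_right _ _)
  refine ⟨_, (le_max_left c d).trans (le_max_right (max a₁ a₂) _),
    fun s x => (B.mono (T := T) e₁).1 s (h₁ s x),
    fun s x => (B.mono (T := T) e₂).1 s (h₂ s x), fun s i => ?_⟩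
  exact ((ha s i).mono (B.mono ((hd ⟨s, i⟩).trans e₃))).2.2

theorem holdsEq_app (hreg : κ.IsRegular) (hΔ : IsSmallCtx κ Δ) (hΔ' : IsSmallCtx κ Δ')
    (f : L.Func) {ρ : ∀ s, Δ s → B.Elem s} {ρ' : ∀ s, Δ' s → B.Elem s}
    {t : ∀ s, L.dom f s → Term L Δ s} {t' : ∀ s, L.dom f s → Term L Δ' s}
    (h : ∀ s i, B.HoldsEq (t s i) ρ (t' s i) ρ') :
    B.HoldsEq (.app f t) ρ (.app f t') ρ' := by
  obtain ⟨c, -⟩ := exists_stage hreg hΔ ρ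
  obtain ⟨a, -, h₁, h₂, hp⟩ := exists_stage_eq hreg hΔ hΔ' (L.dom_small f) h c
  exact ⟨a, h₁, h₂, Prf.eq_app hreg.aleph0_le (B.stage a).small f hp⟩

theorem holds_rel (hreg : κ.IsRegular) (hΔ : IsSmallCtx κ Δ) (hΔ' : IsSmallCtx κ Δ')
    (R : L.Rel) {ρ : ∀ s, Δ s → B.Elem s} {ρ' : ∀ s, Δ' s → B.Elem s}
    {t : ∀ s, L.arity R s → Term L Δ s} {t' : ∀ s, L.arity R s → Term L Δ' s}
    (h : ∀ s i, B.HoldsEq (t s i) ρ (t' s i) ρ') (hR : B.Holds (.rel R t) ρ) :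
    B.Holds (.rel R t') ρ' := by
  obtain ⟨c, hc⟩ := hR
  obtain ⟨a, hca, h₁, h₂, hp⟩ := exists_stage_eq hreg hΔ hΔ' (L.arity_small R) h c
  obtain ⟨_, hR⟩ := hc.mono (B.mono hca)
  exact ⟨a, h₂, Prf.rel_congr hreg.aleph0_le (B.stage a).small R hp hR⟩

variable (B) in
/-- Two names denote the same element. -/
def elemSetoid (hreg : κ.IsRegular) (s : L.Sorts) : Setoid (B.Elem s) where
  r y y' := B.HoldsEq (Term.point s) (pt y) (Term.point s) (pt y')
  iseqv := ⟨fun _ => .refl hreg (isSmallCtx_single hreg.aleph0_le s) _ _,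
    fun h => h.symm hreg.aleph0_le, fun h h' => h.trans hreg.aleph0_le h'⟩

variable (B) in
/-- Some stage of the branch has a term of sort `s`. -/
def Inhab (s : L.Sorts) : Prop := ∃ a, Nonempty (Term L (toCtx (B.stage a).X) s)

variable (B) in
/-- The elements of the model are the named ones, up to known equality. A sort without names that
nevertheless has terms, which can happen only if it occurs in none of the requirements, gets one
element, in order that all function symbols can be interpreted. -/
def Carrier (hreg : κ.IsRegular) (s : L.Sorts) : Type u :=
  Quotient (B.elemSetoid hreg s) ⊕ {_x : PUnit.{u + 1} // B.Inhab s ∧ IsEmpty (B.Elem s)}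

/-- The element of the model with a given name. -/
def cls (hreg : κ.IsRegular) {s : L.Sorts} (y : B.Elem s) : B.Carrier hreg s :=
  .inl (Quotient.mk _ y)

theorem cls_eq {hreg : κ.IsRegular} {s : L.Sorts} {y y' : B.Elem s} :
    cls hreg y = cls hreg y' ↔ B.HoldsEq (Term.point s) (pt y) (Term.point s) (pt y') :=
  Sum.inl_injective.eq_iff.trans (Quotient.eq (r := B.elemSetoid hreg s))

theorem nonempty_carrier_iff {hreg : κ.IsRegular} {s : L.Sorts} :
    Nonempty (B.Carrier hreg s) ↔ B.Inhab s := by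
  constructor
  · rintro ⟨q | x⟩
    · obtain ⟨⟨y, a, hy⟩, -⟩ := Quotient.exists_rep q
      exact ⟨a, ⟨.var ⟨y, hy⟩⟩⟩
    · exact x.2.1
  · intro h
    rcases isEmpty_or_nonempty (B.Elem s) with he | ⟨⟨y⟩⟩
    · exact ⟨.inr ⟨⟨⟩, h, he⟩⟩
    · exact ⟨cls hreg y⟩

theorem nonempty_cod (hreg : κ.IsRegular) (f : L.Func)
    (a : ∀ s, L.dom f s → B.Carrier hreg s) : Nonempty (B.Carrier hreg (L.cod f)) := by
  rw [nonempty_carrier_iff]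
  have h : ∀ s, L.dom f s → B.Inhab s := fun s i => nonempty_carrier_iff.1 ⟨a s i⟩
  choose c t using h
  obtain ⟨d, hd⟩ := exists_bound hreg (L.dom_small f) fun p : Σ s, L.dom f s => c p.1 p.2
  exact ⟨d, ⟨.app f fun s i => (t s i).some.subst fun s' x =>
    .var (Set.inclusion ((B.mono (T := T) (hd ⟨s, i⟩)).1 s') x)⟩⟩

open Classical in
variable (B) in
/-- The model of the branch. A function symbol takes the value it is known to take, if any. -/
noncomputable def model (hreg : κ.IsRegular) : Str L where
  carrier := B.Carrier hreg
  func f a :=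
    if h : ∃ y : B.Elem (L.cod f), ∃ x : ∀ s, L.dom f s → B.Elem s,
      (∀ s i, a s i = cls hreg (x s i)) ∧
        B.HoldsEq (.app f fun _ i => .var i) x (Term.point _) (pt y)
    then cls hreg h.choose else (nonempty_cod hreg f a).some
  rel R a := ∃ x : ∀ s, L.arity R s → B.Elem s, (∀ s i, a s i = cls hreg (x s i)) ∧
    B.Holds (.rel R fun _ i => .var i) x

theorem mk_carrier_le (hreg : κ.IsRegular) (s : L.Sorts) : #((B.model hreg).carrier s) ≤ κ := by
  change #(Quotient _ ⊕ _) ≤ κ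
  rw [mk_sum, lift_id, lift_id]
  refine add_le_of_le hreg.aleph0_le (mk_quotient_le.trans ((mk_subtype_le _).trans
    (mk_ord_toType κ).le)) ((mk_subtype_le _).trans ?_)
  exact (lt_aleph0_of_finite _).le.trans hreg.aleph0_le

theorem var_holdsEq_of_cls_eq (hreg : κ.IsRegular) (hΔ : IsSmallCtx κ Δ)
    {x x' : ∀ s, Δ s → B.Elem s} {s : L.Sorts} {i : Δ s}
    (h : cls hreg (x s i) = cls hreg (x' s i)) : B.HoldsEq (.var i) x (.var i) x' :=
  ((holdsEq_var hreg hΔ i x).trans hreg.aleph0_le (cls_eq.1 h)).trans hreg.aleph0_le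
    ((holdsEq_var hreg hΔ i x').symm hreg.aleph0_le)

theorem model_func (hreg : κ.IsRegular) (f : L.Func) {x : ∀ s, L.dom f s → B.Elem s}
    {y : B.Elem (L.cod f)}
    (h : B.HoldsEq (.app f fun _ i => .var i) x (Term.point _) (pt y)) :
    (B.model hreg).func f (fun s i => cls hreg (x s i)) = cls hreg y := by
  have hex : ∃ y : B.Elem (L.cod f), ∃ x' : ∀ s, L.dom f s → B.Elem s,
      (∀ s i, cls hreg (x s i) = cls hreg (x' s i)) ∧
        B.HoldsEq (.app f fun _ i => .var i) x' (Term.point _) (pt y) := ⟨y, x, fun _ _ => rfl, h⟩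
  obtain ⟨x', hx', hy'⟩ := hex.choose_spec
  refine (dif_pos hex).trans (cls_eq.2 ?_)
  refine (hy'.symm hreg.aleph0_le).trans hreg.aleph0_le (.trans hreg.aleph0_le ?_ h)
  exact holdsEq_app hreg (L.dom_small f) (L.dom_small f) f fun s i =>
    var_holdsEq_of_cls_eq hreg (L.dom_small f) (hx' s i).symm

/-- Known existential formulas among the requirements have named witnesses. -/
theorem exists_of_holds_ex {Y : Ctx L.Sorts} {hY : IsSmallCtx κ Y} {χ : Fml L (Δ.append Y)}
    (hF : (⟨Δ, .ex Y hY χ⟩ : Req L) ∈ F) {ρ : ∀ s, Δ s → B.Elem s}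
    (h : B.Holds (.ex Y hY χ) ρ) :
    ∃ w : ∀ s, Y s → B.Elem s, B.Holds χ fun s => Sum.elim (ρ s) (w s) := by
  obtain ⟨a, ha⟩ := h
  obtain ⟨c, w, hw, hp⟩ := B.resolves _ hF _ _ ha
  have e : (fun s => Sum.elim (names ρ s) (w s)) = names (B := B) fun s =>
      Sum.elim (ρ s) fun y => ⟨w s y, c, hw s (.inr y)⟩ := by
    funext s x
    rcases x with x | y <;> rfl
  exact ⟨fun s y => ⟨w s y, c, hw s (.inr y)⟩, c, e ▸ ⟨hw, hp⟩⟩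

theorem holds_ex_of_holds {Y : Ctx L.Sorts} {hY : IsSmallCtx κ Y} {χ : Fml L (Δ.append Y)}
    {ρ : ∀ s, Δ s → B.Elem s} {w : ∀ s, Y s → B.Elem s}
    (h : B.Holds χ fun s => Sum.elim (ρ s) (w s)) : B.Holds (.ex Y hY χ) ρ := by
  obtain ⟨a, ha, hp⟩ := h
  refine ⟨a, fun s x => ha s (.inl x), hp.cut ?_⟩
  rw [Fml.rename_ex]
  have := Prf.ex_of_subst (T := T) (B.stage a).small hY
    (fun s y => .var ⟨(w s y).1, ha s (.inr y)⟩)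
    (χ.rename fun s => Sum.elim (fun x => .inl ⟨(ρ s x).1, ha s (.inl x)⟩) .inr)
  rw [Fml.subst_rename] at this
  convert this using 1
  unfold Fml.rename
  congr 1
  funext s x
  rcases x with x | y <;> rfl

theorem nonempty_elem (hreg : κ.IsRegular) {s : L.Sorts} (hF : sortReq hreg.aleph0_le s ∈ F)
    (h : Nonempty (B.Carrier hreg s)) : Nonempty (B.Elem s) := by
  obtain ⟨a, ⟨t⟩⟩ := nonempty_carrier_iff.1 h
  obtain ⟨w, -⟩ := exists_of_holds_ex (ρ := fun _ x => x.elim) hF (B := B) ⟨a, fun _ x => x.elim, by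
    rw [Fml.rename_ex]
    have := Prf.ex_of_subst (T := T) (B.stage a).small (isSmallCtx_single hreg.aleph0_le s)
      (fun s' y => y.2 ▸ t) (.top hreg.aleph0_le)
    rw [Fml.subst_top] at this
    rw [Fml.rename, Fml.subst_top]
    exact (Prf.top_intro hreg.aleph0_le (B.stage a).small _).cut this⟩
  exact ⟨w s ⟨⟨⟩, rfl⟩⟩

/-- Elements of the sorts among the requirements have names. -/
theorem exists_names (hreg : κ.IsRegular) (hF : sortReqs hreg.aleph0_le Δ ⊆ F)
    (v : ∀ s, Δ s → B.Carrier hreg s) :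
    ∃ ρ : ∀ s, Δ s → B.Elem s, v = fun s x => cls hreg (ρ s x) := by
  have : ∀ s x, ∃ y, v s x = cls hreg y := by
    intro s x
    obtain ⟨y⟩ := nonempty_elem hreg (hF ⟨⟨s, x⟩, rfl⟩) ⟨v s x⟩
    rcases h : v s x with q | e
    · obtain ⟨y, rfl⟩ := Quotient.exists_rep q
      exact ⟨y, rfl⟩
    · exact (e.2.2.false y).elim
  choose ρ hρ using this
  exact ⟨ρ, funext fun s => funext fun x => hρ s x⟩

/-- The value of a term in the model is a name that the term is known to be equal to. -/
theorem exists_eval (hreg : κ.IsRegular) (hΔ : IsSmallCtx κ Δ) {s : L.Sorts} (t : Term L Δ s)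
    (hF : funcReq hreg.aleph0_le '' t.funcs ⊆ F) (ρ : ∀ s, Δ s → B.Elem s) :
    ∃ y : B.Elem s, t.eval (B.model hreg) (fun s x => cls hreg (ρ s x)) = cls hreg y ∧
      B.HoldsEq t ρ (Term.point s) (pt y) := by
  have hκ := hreg.aleph0_le
  induction t with
  | var x => exact ⟨ρ _ x, rfl, holdsEq_var hreg hΔ x ρ⟩
  | app f t ih =>
    have hsub : ∀ s i, funcReq hκ '' (t s i).funcs ⊆ F := fun s i =>
      (Set.image_mono ((Set.subset_iUnion (fun p : Σ s, L.dom f s => (t p.1 p.2).funcs)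
        ⟨s, i⟩).trans Set.subset_union_right)).trans hF
    choose x hx hx' using fun s i => ih s i (hsub s i)
    -- the values of the arguments have a value under `f`, and it has a name
    have htot : B.Holds (funcReq hκ f).2 x := by
      obtain ⟨a, ha⟩ := exists_stage hreg (L.dom_small f) x
      refine ⟨a, ha, ?_⟩
      simp only [funcReq]
      rw [Fml.rename_ex]
      have := Prf.ex_of_subst (T := T) (B.stage a).small (isSmallCtx_single hκ (L.cod f))
        (fun s' y => y.2 ▸ .app f fun s i => .var ⟨(x s i).1, ha s i⟩)
        (.eq (.app f fun s i => .var (.inl ⟨(x s i).1, ha s i⟩)) (.var (.inr ⟨⟨⟩, rfl⟩)))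
      simp only [Fml.subst, Term.subst, Sum.elim_inl, Sum.elim_inr] at this
      exact (Prf.eq_rfl hκ (B.stage a).small _).cut this
    obtain ⟨w, c, hc, hp⟩ := exists_of_holds_ex (hF ⟨f, .inl rfl, rfl⟩) htot
    have hy : B.HoldsEq (.app f fun _ i => .var i) x (Term.point _) (pt (w _ ⟨⟨⟩, rfl⟩)) := by
      refine ⟨c, fun s i => hc s (.inl i), ?_, hp⟩
      rintro _ ⟨_, rfl⟩
      exact hc _ (.inr ⟨⟨⟩, rfl⟩)
    refine ⟨w _ ⟨⟨⟩, rfl⟩, ?_, ?_⟩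
    · rw [← model_func hreg f hy]
      simp only [Term.eval]
      congr 1
      funext s i
      exact hx s i
    · refine .trans hκ (holdsEq_app hreg hΔ (L.dom_small f) f fun s i => ?_) hy
      exact (hx' s i).trans hκ ((holdsEq_var hreg (L.dom_small f) i x).symm hκ)

theorem funcs_subset_of_mem {Γ : Ctx L.Sorts} (hκ : ℵ₀ ≤ κ) {s : L.Sorts} {A : Set L.Func}
    (h : funcReq hκ '' A ⊆ F) {t : Term L Γ s} (ht : t.funcs ⊆ A) :
    funcReq hκ '' t.funcs ⊆ F :=
  (Set.image_mono ht).trans h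

/-- A formula all of whose requirements are met is true in the model if and only if it is
eventually known. -/
theorem sat_iff (hreg : κ.IsRegular) (hΔ : IsSmallCtx κ Δ) (χ : Fml L Δ)
    (hF : χ.reqs hreg.aleph0_le ⊆ F) (ρ : ∀ s, Δ s → B.Elem s) :
    χ.Sat (B.model hreg) (fun s x => cls hreg (ρ s x)) ↔ B.Holds χ ρ := by
  have hκ := hreg.aleph0_le
  induction χ with
  | eq t t' =>
    obtain ⟨y, hy, hy'⟩ := exists_eval hreg hΔ t
      (funcs_subset_of_mem hκ hF Set.subset_union_left) ρ
    obtain ⟨z, hz, hz'⟩ := exists_eval hreg hΔ t'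
      (funcs_subset_of_mem hκ hF Set.subset_union_right) ρ
    have : B.Holds (.eq t t') ρ ↔ B.HoldsEq t ρ t' ρ :=
      exists_congr fun a => ⟨fun ⟨h, hp⟩ => ⟨h, h, hp⟩, fun ⟨h, _, hp⟩ => ⟨h, hp⟩⟩
    change t.eval _ _ = t'.eval _ _ ↔ _
    rw [this, hy, hz]
    exact (cls_eq (hreg := hreg)).trans ⟨fun h => (hy'.trans hκ h).trans hκ (hz'.symm hκ),
      fun h => ((hy'.symm hκ).trans hκ h).trans hκ hz'⟩
  | rel R t =>
    choose y hy hy' using fun s i => exists_eval hreg hΔ (t s i) (funcs_subset_of_mem hκ hF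
      (Set.subset_iUnion (fun p : Σ s, L.arity R s => (t p.1 p.2).funcs) ⟨s, i⟩)) ρ
    have hR := L.arity_small R
    have hvar : ∀ s i, B.HoldsEq (t s i) ρ (.var i) y := fun s i =>
      (hy' s i).trans hκ ((holdsEq_var hreg hR i y).symm hκ)
    simp only [Fml.Sat, hy]
    constructor
    · rintro ⟨x, hx, hp⟩
      exact holds_rel hreg hR hΔ R (fun s i => (var_holdsEq_of_cls_eq hreg hR
        (hx s i).symm).trans hκ ((hvar s i).symm hκ)) hp
    · exact fun h => ⟨y, fun _ _ => rfl, holds_rel hreg hΔ hR R hvar h⟩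
  | conj ι hι χ ih =>
    have hsub : ∀ i, (χ i).reqs hκ ⊆ F := fun i =>
      (Set.subset_iUnion (fun i => (χ i).reqs hκ) i).trans hF
    simp only [Fml.Sat, fun i => ih i hΔ (hsub i) ρ]
    constructor
    · intro h
      choose a ha using h
      obtain ⟨c, hc⟩ := exists_stage hreg hΔ ρ
      obtain ⟨d, hd⟩ := exists_bound hreg hι a
      refine ⟨max c d, fun s x => (B.mono (T := T) (le_max_left c d)).1 s (hc s x),
        Prf.conj_intro (B.stage _).small _ fun i => ?_⟩
      exact ((ha i).mono (B.mono ((hd i).trans (le_max_right c d)))).2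
    · rintro ⟨a, ha, hp⟩ i
      exact ⟨a, ha, hp.cut (Prf.conj_elim (B.stage a).small _
        (fun i => (χ i).rename fun s x => ⟨(ρ s x).1, ha s x⟩) i)⟩
  | disj ι hι χ ih =>
    have hsub : ∀ i, (χ i).reqs hκ ⊆ F := fun i =>
      ((Set.subset_iUnion (fun i => (χ i).reqs hκ) i).trans Set.subset_union_right).trans hF
    simp only [Fml.Sat, fun i => ih i hΔ (hsub i) ρ]
    constructor
    · rintro ⟨i, a, ha, hp⟩
      exact ⟨a, ha, hp.cut (Prf.disj_intro (B.stage a).small _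
        (fun i => (χ i).rename fun s x => ⟨(ρ s x).1, ha s x⟩) i)⟩
    · rintro ⟨a, ha⟩
      obtain ⟨c, i, hi⟩ := B.resolves _ (hF (.inl rfl)) _ a ha
      exact ⟨i, c, hi⟩
  | ex Y hY χ ih =>
    have hsub : χ.reqs hκ ⊆ F :=
      (Set.subset_union_right.trans Set.subset_union_right).trans hF
    have hsort : sortReqs hκ Y ⊆ F :=
      (Set.subset_union_left.trans Set.subset_union_right).trans hF
    have e : ∀ (w : ∀ s, Y s → B.Elem s), (fun s => Sum.elim (fun x => cls hreg (ρ s x))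
        fun y => cls hreg (w s y)) = fun s x => cls hreg (Sum.elim (ρ s) (w s) x) := by
      intro w
      funext s x
      rcases x with x | y <;> rfl
    constructor
    · rintro ⟨w, hw⟩
      obtain ⟨w, rfl⟩ := exists_names hreg hsort w
      refine holds_ex_of_holds (w := w) ((ih (hΔ.append hκ hY) hsub _).1 ?_)
      rw [← e]
      exact hw
    · intro h
      obtain ⟨w, hw⟩ := exists_of_holds_ex (hF (.inl rfl)) h
      refine ⟨fun s y => cls hreg (w s y), ?_⟩
      have := (ih (hΔ.append hκ hY) hsub _).2 hw
      rw [← e] at this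
      exact this

theorem models_of_mem (hreg : κ.IsRegular) {τ : Sequent L} (hτ : τ ∈ T)
    (hF : τ.reqs hreg.aleph0_le ⊆ F) : (B.model hreg).Models τ := by
  intro v hv
  obtain ⟨ρ, rfl⟩ := exists_names hreg (Set.subset_union_left.trans hF) v
  have hF' := Set.subset_union_right.trans hF
  rw [sat_iff hreg τ.small _ (Set.subset_union_left.trans hF')] at hv
  rw [sat_iff hreg τ.small _ (Set.subset_union_right.trans hF')]
  obtain ⟨a, ha, hp⟩ := hv
  exact ⟨a, ha, hp.cut ((Prf.ax τ hτ).rename (B.stage a).small _)⟩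

end Branch

end InfLogic

theorem mainTheorem6 (κ : Cardinal.{u}) (hreg : κ.IsRegular) (hpow : κ ^< κ = κ)
    (L : InfLogic.Signature κ) (T : Set (InfLogic.Sequent L))
    (hT : #T ≤ Cardinal.lift.{u + 1} κ) (σ : InfLogic.Sequent L)
    (hσ : ∀ M : InfLogic.Str L, (∀ s, #(M.carrier s) ≤ κ) →
      (∀ τ ∈ T, M.Models τ) → M.Models σ) :
    InfLogic.Provable T σ := by
  open InfLogic in
  have hκ := hreg.aleph0_le
  -- the variables of `σ` are named by variables of the pool
  have hemb : ∀ s, Nonempty (σ.ctx s ↪ Pool L s) := fun s => by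
    rw [← le_def, mk_ord_toType]
    exact (σ.small.mk_lt s).le
  let ρ : ∀ s, σ.ctx s → Pool L s := fun s => (hemb s).some
  have hρ : ∀ s, Function.Injective (ρ s) := fun s => (hemb s).some.injective
  let S₀ : Stage L := ⟨fun s => Set.range (ρ s), σ.small.range ρ,
    σ.lhs.rename fun s => Set.rangeFactorization (ρ s)⟩
  have hmem : ∀ s x, ρ s x ∈ S₀.X s := fun s x => ⟨x, rfl⟩
  by_contra hcon
  have hS₀ : ¬ S₀.Forces T σ.rhs ρ := by
    rintro ⟨h, hp⟩
    exact hcon (Prf.of_rename σ.small (fun s => Set.rangeFactorization (ρ s))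
      (fun s => (Equiv.ofInjective _ (hρ s)).symm)
      (fun s x => (Equiv.ofInjective _ (hρ s)).symm_apply_apply x) hp)
  let F : Set (Req L) := σ.reqs hκ ∪ ⋃ τ ∈ T, τ.reqs hκ
  have hF : AtMost κ F := (σ.atMost_reqs hκ).union hκ
    (AtMost.biUnion hκ (AtMost.of_mk_le (by rw [lift_id'.{u, u + 1}]; exact hT)) fun τ _ => τ.atMost_reqs hκ)
  have hsmall : ∀ p ∈ F, IsSmallCtx κ p.1 := by
    rintro p (hp | hp)
    · exact σ.isSmallCtx_reqs hκ p hp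
    · obtain ⟨τ, -, hp⟩ := Set.mem_iUnion₂.1 hp
      exact τ.isSmallCtx_reqs hκ p hp
  obtain ⟨B, hB₀, hB⟩ := exists_branch hreg hpow hF hsmall S₀ hmem hS₀
  have hM := hσ (B.model hreg) (Branch.mk_carrier_le hreg) fun τ hτ =>
    Branch.models_of_mem hreg hτ ((Set.subset_biUnion_of_mem (u := fun τ => τ.reqs hκ) hτ).trans
      Set.subset_union_right)
  obtain ⟨a⟩ := nonempty_toType_ord hκ
  let ρ' : ∀ s, σ.ctx s → B.Elem s := fun s x => ⟨ρ s x, a, (hB₀ a).1 s (hmem s x)⟩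
  have hFσ : σ.lhs.reqs hκ ∪ σ.rhs.reqs hκ ⊆ F :=
    Set.subset_union_right.trans Set.subset_union_left
  have hl := (Branch.sat_iff hreg σ.small σ.lhs (Set.subset_union_left.trans hFσ) ρ').2
    ⟨a, Stage.Forces.mono (hB₀ a) ⟨hmem, Prf.id S₀.small _⟩⟩
  obtain ⟨c, hc⟩ := (Branch.sat_iff hreg σ.small σ.rhs (Set.subset_union_right.trans hFσ) ρ').1
    (hM _ hl)
  exact hB c hc
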